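/- Let $\lambda,k,\theta>0$ be real. Updates (packets $n=0,1,2,\dots$) are generated at the points $t_0<t_1<\cdots$ of a Poisson process of rate $\lambda$ on $[0,\infty)$, and packet $n$ needs a service time $S_n$; the $S_n$ are i.i.d. $\Gamma(k,\theta)$, with density $s^{k-1}e^{-s/\theta}/(\theta^k\Gamma(k))$ on $(0,\infty)$, and independent of the arrivals. The server is empty at time $0$ and works under last come first served with preemption: a packet enters service when it arrives and discards the packet in service, if any. So packet $n$ is successful, and is received at time $t_n'=t_n+S_n$, if and only if $t_n+S_n<t_{n+1}$. Let $\Delta_0\ge 0$ be the (possibly random) age at time $0$. The age at time $t$ is $\Delta(t)=t-u(t)$, where $u(t)$ is the largest of $-\Delta_0$ and the generation times of the successful packets received by time $t$. Let $I_0<I_1<\cdots$ be the indices of the successful packets, $T_i=t'_{I_i}-t_{I_i}$ their system times, $Y_i=t'_{I_{i+1}}-t'_{I_i}$ the interdeparture times, $Q_i=\int_{t'_{I_i}}^{t'_{I_{i+1}}}\Delta(t)\,dt$ the area under the age curve between consecutive receptions, and let $\lambda_e=\lambda\,\mathbb P(\text{packet } n \text{ is successful})$ be the effective update rate. Then, almost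 surely, infinitely many packets are successful, $\Delta(\cdot)$ is integrable on every $[0,\tau]$, and $$\Delta:=\lim_{\tau\to\infty}\frac1\tau\int_0^\tau\Delta(t)\,dt=\lambda_e\,\mathbb E(Q_i)=\frac{(1+\lambda\theta)^k}{\lambda},$$ where $Q_i$ is integrable and neither $\lambda_e$ nor $\mathbb E(Q_i)$ depends on the packet. Moreover: 1. $\lambda_e=\lambda(1+\lambda\theta)^{-k}$, and almost surely the number of successful packets generated in $[0,\tau]$ is finite for every $\tau$ and, divided by $\tau$, converges to $\lambda_e$ as $\tau\to\infty$. 2. For every $i$, $T_i$ has the distribution $\Gamma\left(k,\frac{\theta}{1+\lambda\theta}\right)$. 3. For every $i$ and every real $s<\lambda$ with $s(1+\theta(\lambda-s))^k<\lambda$ (in particular for all $s\le 0$ and all $s$ near $0$), $e^{sY_i}$ is integrable and $\mathbb E(e^{sY_i})=\dfrac{\lambda}{\lambda-s(1+\theta(\lambda-s))^k}$. -/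

import Mathlib

open MeasureTheory ProbabilityTheory Filter Topology

namespace LCFS

/-!  Sample-path description of the queue "last come first served with preemption".
Packets are numbered `0, 1, 2, …`. A sample path consists of
* `x : ℕ → ℝ`: `x 0` is the time from `0` to the first arrival and `x (n + 1)` is the time between
  the arrivals of packets `n` and `n + 1`;
* `s : ℕ → ℝ`: `s n` is the service time required by packet `n`;
* `a₀ : ℝ`: the age at time `0`.
The queue is empty at time `0`. -/

noncomputable section

/-- Generation (= arrival) time of packet `n`. -/
def arrival (x : ℕ → ℝ) (n : ℕ) : ℝ := ∑ j ∈ Finset.range (n + 1), x j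

/-- The instant at which the service of packet `n` ends, if it is not interrupted. Under preemption
every packet enters service at the very instant at which it arrives. -/
def reception (x s : ℕ → ℝ) (n : ℕ) : ℝ := arrival x n + s n

/-- Packet `n` is successful: its service ends before the next arrival preempts it. -/
def Delivered (x s : ℕ → ℝ) (n : ℕ) : Prop := reception x s n < arrival x (n + 1)

/-- Generation time of the newest packet which the monitor has received by time `t`. The status
known to the monitor at time `0` has generation time `-a₀`. -/
def newest (x s : ℕ → ℝ) (a₀ t : ℝ) : ℝ :=
  sSup (insert (-a₀) {u | ∃ n, Delivered x s n ∧ reception x s n ≤ t ∧ u = arrival x n})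

/-- Instantaneous age of information at time `t`. -/
def age (x s : ℕ → ℝ) (a₀ t : ℝ) : ℝ := t - newest x s a₀ t

/-- Average of the age over the time window `[0, τ]`. -/
def averageAge (x s : ℕ → ℝ) (a₀ τ : ℝ) : ℝ := (1 / τ) * ∫ t in (0 : ℝ)..τ, age x s a₀ t

/-- The index, among all packets, of the successful packet number `i` (counted from `0`). -/
def successIndex (x s : ℕ → ℝ) (i : ℕ) : ℕ := Nat.nth (Delivered x s) i

/-- The instant at which successful packet number `i` is received. -/
def departure (x s : ℕ → ℝ) (i : ℕ) : ℝ := reception x s (successIndex x s i)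

/-- Time spent in the queue by successful packet number `i`. -/
def systemTime (x s : ℕ → ℝ) (i : ℕ) : ℝ :=
  departure x s i - arrival x (successIndex x s i)

/-- Time between the receptions of the successful packets number `i` and `i + 1`. -/
def interdeparture (x s : ℕ → ℝ) (i : ℕ) : ℝ := departure x s (i + 1) - departure x s i

/-- Area under the age curve between the receptions of the successful packets number `i` and
`i + 1`. -/
def ageArea (x s : ℕ → ℝ) (a₀ : ℝ) (i : ℕ) : ℝ :=
  ∫ t in (departure x s i)..(departure x s (i + 1)), age x s a₀ t

/-- Number of successful packets generated in `[0, τ]`. -/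
def numSuccess (x s : ℕ → ℝ) (τ : ℝ) : ℕ := {n | Delivered x s n ∧ arrival x n ≤ τ}.ncard

/-- The sample path at `ω` of a sequence of random variables. -/
def path {Ω : Type*} (X : ℕ → Ω → ℝ) (ω : Ω) : ℕ → ℝ := fun n => X n ω

/-- The effective update rate: the arrival rate `lam` times the probability that a packet (here
packet `n`) is received successfully. -/
def effectiveRate {Ω : Type*} [MeasurableSpace Ω] (μ : Measure Ω) (lam : ℝ) (X S : ℕ → Ω → ℝ)
    (n : ℕ) : ℝ :=
  lam * μ.real {ω | Delivered (path X ω) (path S ω) n}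

/-- The input of the queue: updates arrive as a Poisson process of rate `lam` (i.i.d. exponential
interarrival times), the service times are i.i.d. with the gamma distribution of shape `k` and
scale `θ` (that is, rate `1 / θ`), and all these variables are independent. -/
structure PoissonGammaInput {Ω : Type*} [MeasurableSpace Ω] (μ : Measure Ω) (lam k θ : ℝ)
    (X S : ℕ → Ω → ℝ) : Prop where
  measurable_interarrival : ∀ n, Measurable (X n)
  measurable_service : ∀ n, Measurable (S n)
  law_interarrival : ∀ n, μ.map (X n) = expMeasure lam
  law_service : ∀ n, μ.map (S n) = gammaMeasure k (1 / θ)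
  indep : iIndepFun (fun j : ℕ ⊕ ℕ => Sum.elim X S j) μ

end

end LCFS

namespace LCFS

open scoped ENNReal

/-! ### The gamma and exponential distributions -/

/-! Packet `n` succeeds exactly when `S n < X (n + 1)`, so everything is driven by the pairs `(S n,
X (n + 1))`, which are i.i.d. and each independent of what is known at the arrival of packet `n`.
With an exponential clock the success event tilts the gamma law by `exp (-lam * s)`: the success
probability is `p = (1 + lam * θ) ^ (-k)`, a successful service time is gamma with rate `1 / θ +
lam`, and by lack of memory the remaining time to the next arrival is again exponential and
independent of it (`lintegral_pairLaw_shift`).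

From one reception to the next there are an exponential residual, a geometric number of failed
interarrival times and one successful service time. Summing over the position of success number `i`
and over the number of failures gives a geometric series, hence the joint transform of `T` and `Y`
(`lintegral_systemTime_interdeparture`): they are independent, with the stated laws. With `M = (1 +
lam * θ) ^ k / lam` and `t = E T`, the transform yields `E (T Y) = t M` and `E Y² = 2 (M² - t M)`.
The area being `T Y + Y² / 2`, its mean is `M²`.

The time average is obtained separately, one interarrival period at a time. The ages `A n` at
arrivals satisfy `A (n + 1) = X (n + 1) + F n * A n`, with `F n` the failure indicator, and the area
over a period is `A n * min (S n) (X (n + 1)) + X (n + 1) ^ 2 / 2`. The second moments of `A n` are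
bounded, so `A n` times a centred function of pair `n` is an orthogonal sequence obeying a strong
law (`ae_tendsto_average_of_orthogonal`). Functions of pair `n` weighted by `A n` may thus be
replaced by their means: the recursion makes the average of `A n` tend to `M`, then the mean area
per period tends to `M / lam`. Periods have mean length `1 / lam`, and a deterministic sandwich
between arrivals gives the limit `M`. Probabilistic estimates use initial age `0`; the actual one
matters only up to the first success, so nothing about its law is needed. -/

lemma measurable_gammaPDF (a r : ℝ) : Measurable (gammaPDF a r) :=
  (measurable_gammaPDFReal a r).ennreal_ofReal

lemma lintegral_gammaMeasure (a r : ℝ) {f : ℝ → ℝ≥0∞} (hf : Measurable f) :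
    ∫⁻ s, f s ∂gammaMeasure a r = ∫⁻ s, gammaPDF a r s * f s := by
  rw [gammaMeasure, lintegral_withDensity_eq_lintegral_mul _ (measurable_gammaPDF a r) hf]
  rfl

lemma ae_pos_gammaMeasure (a r : ℝ) : ∀ᵐ s ∂gammaMeasure a r, 0 < s := by
  rw [gammaMeasure, ae_withDensity_iff (measurable_gammaPDF a r)]
  -- The origin is removed as a null set: for `a = 1` the density does not vanish there.
  filter_upwards [compl_mem_ae_iff.2 (measure_singleton (μ := (volume : Measure ℝ)) 0)]
    with s hs hpdf
  rcases lt_trichotomy s 0 with h | h | h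
  · exact absurd (gammaPDF_of_neg h) hpdf
  · exact absurd h hs
  · exact h

/-- Exponential tilting of a gamma distribution changes its rate. -/
lemma lintegral_exp_mul_gammaMeasure {a r c : ℝ} (ha : 0 < a) (hr : 0 < r) (hc : 0 < r + c)
    {f : ℝ → ℝ≥0∞} (hf : Measurable f) :
    ∫⁻ s, f s * ENNReal.ofReal (Real.exp (-(c * s))) ∂gammaMeasure a r =
      ENNReal.ofReal ((r / (r + c)) ^ a) * ∫⁻ s, f s ∂gammaMeasure a (r + c) := by
  rw [lintegral_gammaMeasure _ _ (by fun_prop), lintegral_gammaMeasure _ _ hf,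
    ← lintegral_const_mul _ ((measurable_gammaPDF _ _).fun_mul hf)]
  refine lintegral_congr fun s => ?_
  have key : gammaPDF a r s * ENNReal.ofReal (Real.exp (-(c * s))) =
      ENNReal.ofReal ((r / (r + c)) ^ a) * gammaPDF a (r + c) s := by
    rcases lt_or_ge s 0 with h | h
    · simp [gammaPDF_of_neg h]
    · have hΓ := Real.Gamma_pos_of_pos ha
      rw [gammaPDF_of_nonneg h, gammaPDF_of_nonneg h, ← ENNReal.ofReal_mul (by positivity),
        ← ENNReal.ofReal_mul (by positivity), Real.div_rpow hr.le hc.le]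
      congr 1
      have h1 : Real.exp (-((r + c) * s)) = Real.exp (-(r * s)) * Real.exp (-(c * s)) := by
        rw [← Real.exp_add]; ring_nf
      have h2 : (r + c) ^ a ≠ 0 := (Real.rpow_pos_of_pos hc a).ne'
      rw [h1]
      field_simp
  rw [mul_comm (f s), ← mul_assoc, key, mul_assoc]

/-- Size biasing of a gamma distribution increases its shape by one. -/
lemma lintegral_ofReal_mul_gammaMeasure {a r : ℝ} (ha : 0 < a) (hr : 0 < r)
    {f : ℝ → ℝ≥0∞} (hf : Measurable f) :
    ∫⁻ s, ENNReal.ofReal s * f s ∂gammaMeasure a r =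
      ENNReal.ofReal (a / r) * ∫⁻ s, f s ∂gammaMeasure (a + 1) r := by
  rw [lintegral_gammaMeasure _ _ (by fun_prop), lintegral_gammaMeasure _ _ hf,
    ← lintegral_const_mul _ ((measurable_gammaPDF _ _).fun_mul hf)]
  refine lintegral_congr fun s => ?_
  have key : gammaPDF a r s * ENNReal.ofReal s =
      ENNReal.ofReal (a / r) * gammaPDF (a + 1) r s := by
    rcases le_or_gt s 0 with h | h
    · rw [ENNReal.ofReal_of_nonpos h]
      rcases h.lt_or_eq with h | h
      · simp [gammaPDF_of_neg h]
      · subst h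
        simp [gammaPDF_of_nonneg le_rfl, Real.zero_rpow ha.ne']
    · have hΓ := Real.Gamma_pos_of_pos ha
      rw [gammaPDF_of_nonneg h.le, gammaPDF_of_nonneg h.le, ← ENNReal.ofReal_mul (by positivity),
        ← ENNReal.ofReal_mul (by positivity), Real.Gamma_add_one ha.ne', Real.rpow_add_one hr.ne',
        add_sub_cancel_right, Real.rpow_sub_one h.ne']
      congr 1
      field_simp
  rw [← mul_assoc, key, mul_assoc]

lemma lintegral_id_gammaMeasure {a r : ℝ} (ha : 0 < a) (hr : 0 < r) :
    ∫⁻ s, ENNReal.ofReal s ∂gammaMeasure a r = ENNReal.ofReal (a / r) := by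
  have := isProbabilityMeasure_gammaMeasure (a := a + 1) (by positivity) hr
  simpa using lintegral_ofReal_mul_gammaMeasure ha hr (f := fun _ => 1) measurable_const

lemma lintegral_sq_gammaMeasure {a r : ℝ} (ha : 0 < a) (hr : 0 < r) :
    ∫⁻ s, ENNReal.ofReal (s ^ 2) ∂gammaMeasure a r = ENNReal.ofReal (a * (a + 1) / r ^ 2) := by
  have h := lintegral_ofReal_mul_gammaMeasure ha hr (f := fun s => ENNReal.ofReal s) (by fun_prop)
  rw [lintegral_id_gammaMeasure (by positivity) hr, ← ENNReal.ofReal_mul (by positivity)] at h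
  rw [show a * (a + 1) / r ^ 2 = a / r * ((a + 1) / r) by field_simp, ← h]
  refine lintegral_congr_ae ?_
  filter_upwards [ae_pos_gammaMeasure a r] with s hs
  rw [← ENNReal.ofReal_mul hs.le, sq]

lemma lintegral_exp_expMeasure {lam z : ℝ} (hlam : 0 < lam) (hz : z < lam) :
    ∫⁻ x, ENNReal.ofReal (Real.exp (z * x)) ∂expMeasure lam = ENNReal.ofReal (lam / (lam - z)) := by
  have h0 : 0 < lam + -z := by linarith
  have := isProbabilityMeasure_gammaMeasure one_pos h0
  simpa [expMeasure, sub_eq_add_neg] using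
    lintegral_exp_mul_gammaMeasure one_pos hlam h0 (f := fun _ => 1) measurable_const

/-- Lack of memory of the exponential distribution. -/
lemma lintegral_expMeasure_shift {lam s : ℝ} (hs : 0 ≤ s) {f : ℝ → ℝ≥0∞}
    (hf : Measurable f) :
    ∫⁻ x, (if s < x then f (x - s) else 0) ∂expMeasure lam =
      ENNReal.ofReal (Real.exp (-(lam * s))) * ∫⁻ x, f x ∂expMeasure lam := by
  have hm : Measurable fun x => if s < x then f (x - s) else 0 :=
    Measurable.ite measurableSet_Ioi (by fun_prop) measurable_const
  rw [expMeasure, lintegral_gammaMeasure _ _ hm, lintegral_gammaMeasure _ _ hf,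
    ← lintegral_const_mul _ ((measurable_gammaPDF _ _).fun_mul hf),
    ← lintegral_sub_right_eq_self
      (fun x => ENNReal.ofReal (Real.exp (-(lam * s))) * (gammaPDF 1 lam x * f x)) s]
  refine lintegral_congr_ae ?_
  -- At `x = s` the left side is zero while the shifted density is not, so this null set is
  -- discarded.
  filter_upwards [compl_mem_ae_iff.2 (measure_singleton (μ := (volume : Measure ℝ)) s)] with x hx
  rcases lt_trichotomy s x with h | h | h
  · rw [if_pos h, ← mul_assoc, gammaPDF_of_nonneg (hs.trans h.le),
      gammaPDF_of_nonneg (sub_nonneg.2 h.le), ← ENNReal.ofReal_mul (by positivity)]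
    congr 2
    have h1 : Real.exp (-(lam * x)) = Real.exp (-(lam * s)) * Real.exp (-(lam * (x - s))) := by
      rw [← Real.exp_add]; ring_nf
    rw [h1]
    simp
    ring
  · exact absurd h.symm hx
  · rw [if_neg h.not_gt, gammaPDF_of_neg (sub_neg.2 h)]
    simp

/-- The joint law of a service time and of the interarrival time which follows. -/
noncomputable def pairLaw (lam k θ : ℝ) : Measure (ℝ × ℝ) :=
  (gammaMeasure k (1 / θ)).prod (expMeasure lam)

/-! ### Integrals over one service time and the following interarrival time -/

section pair

variable {lam k θ : ℝ}

lemma isProbabilityMeasure_pairLaw (hlam : 0 < lam) (hk : 0 < k) (hθ : 0 < θ) :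
    IsProbabilityMeasure (pairLaw lam k θ) := by
  have := isProbabilityMeasure_gammaMeasure hk (one_div_pos.2 hθ)
  have := isProbabilityMeasure_expMeasure hlam
  unfold pairLaw; infer_instance

lemma measurableSet_lt_pair : MeasurableSet {q : ℝ × ℝ | q.1 < q.2} :=
  measurableSet_lt measurable_fst measurable_snd

lemma measurable_ite_lt {f g : ℝ × ℝ → ℝ≥0∞} (hf : Measurable f) (hg : Measurable g) :
    Measurable fun q : ℝ × ℝ => if q.1 < q.2 then f q else g q :=
  Measurable.ite measurableSet_lt_pair hf hg

/-- For fixed `s`, lack of memory turns the excess `x - s` into a fresh exponential variable at the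
cost of the factor `exp (-(lam * s))`; that factor then tilts the gamma law from rate `1 / θ` to `1
/ θ + lam`. Thus on success the service time and the excess are independent. -/
lemma lintegral_pairLaw_shift (hlam : 0 < lam) (hk : 0 < k) (hθ : 0 < θ)
    {f g : ℝ → ℝ≥0∞} (hf : Measurable f) (hg : Measurable g) :
    ∫⁻ q, (if q.1 < q.2 then g q.1 * f (q.2 - q.1) else 0) ∂pairLaw lam k θ =
      ENNReal.ofReal ((1 + lam * θ) ^ (-k)) * (∫⁻ s, g s ∂gammaMeasure k ((1 + lam * θ) / θ)) *
        ∫⁻ x, f x ∂expMeasure lam := by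
  have := isProbabilityMeasure_gammaMeasure hk (one_div_pos.2 hθ)
  have := isProbabilityMeasure_expMeasure hlam
  have hr : (0 : ℝ) < 1 / θ + lam := by positivity
  have e1 : (1 + lam * θ) ^ (-k) = (1 / θ / (1 / θ + lam)) ^ k := by
    rw [Real.rpow_neg (by positivity), ← Real.inv_rpow (by positivity)]
    congr 1; field_simp
  have e2 : (1 + lam * θ) / θ = 1 / θ + lam := by field_simp
  rw [e1, e2, ← lintegral_exp_mul_gammaMeasure hk (one_div_pos.2 hθ) hr hg, pairLaw,
    lintegral_prod _ (measurable_ite_lt (by fun_prop) measurable_const).aemeasurable,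
    ← lintegral_mul_const _ (by fun_prop)]
  refine lintegral_congr_ae ?_
  filter_upwards [ae_pos_gammaMeasure k (1 / θ)] with s hs
  rw [mul_assoc, ← lintegral_expMeasure_shift hs.le hf, ← lintegral_const_mul]
  · refine lintegral_congr fun x => ?_
    split_ifs <;> simp
  · exact Measurable.ite measurableSet_Ioi (by fun_prop) measurable_const

lemma lintegral_pairLaw_snd (hlam : 0 < lam) (hk : 0 < k) (hθ : 0 < θ)
    {f : ℝ → ℝ≥0∞} (hf : Measurable f) :
    ∫⁻ q, f q.2 ∂pairLaw lam k θ = ∫⁻ x, f x ∂expMeasure lam := by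
  have := isProbabilityMeasure_gammaMeasure hk (one_div_pos.2 hθ)
  have := isProbabilityMeasure_expMeasure hlam
  have h := lintegral_prod_mul (μ := gammaMeasure k (1 / θ)) (ν := expMeasure lam)
    (f := fun _ => 1) (g := f) (by fun_prop) (by fun_prop)
  simpa only [pairLaw, one_mul, lintegral_const, measure_univ] using h

/-- Tilting the conditional law by `z` and multiplying by the success probability amounts to tilting
the original gamma law by `z - lam`. -/
lemma lintegral_gammaMeasure_tilted (hlam : 0 < lam) (hk : 0 < k) (hθ : 0 < θ) {z : ℝ}
    (hz : z < lam) :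
    ENNReal.ofReal ((1 + lam * θ) ^ (-k)) *
      ∫⁻ s, ENNReal.ofReal (Real.exp (z * s)) ∂gammaMeasure k ((1 + lam * θ) / θ) =
    ENNReal.ofReal ((1 + θ * (lam - z)) ^ (-k)) := by
  have hr : (0 : ℝ) < (1 + lam * θ) / θ := by positivity
  have hl : 0 < lam - z := by linarith
  have e : (1 + lam * θ) / θ + -z = (1 + θ * (lam - z)) / θ := by field_simp; ring
  have hr' : (0 : ℝ) < (1 + lam * θ) / θ + -z := by rw [e]; positivity
  have := isProbabilityMeasure_gammaMeasure hk hr'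
  have h := lintegral_exp_mul_gammaMeasure hk hr hr' (f := fun _ => 1) measurable_const
  simp only [one_mul, neg_mul, neg_neg, lintegral_const, measure_univ, mul_one] at h
  rw [h, ← ENNReal.ofReal_mul (by positivity), e]
  congr 1
  have e3 : (1 + lam * θ) / θ / ((1 + θ * (lam - z)) / θ) =
      (1 + lam * θ) / (1 + θ * (lam - z)) := by field_simp
  rw [e3, Real.div_rpow (by positivity) (by positivity), Real.rpow_neg (by positivity),
    Real.rpow_neg (by positivity)]
  have := Real.rpow_pos_of_pos (show 0 < 1 + lam * θ by positivity) k
  field_simp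

lemma lintegral_pairLaw_success (hlam : 0 < lam) (hk : 0 < k) (hθ : 0 < θ) {z : ℝ}
    (hz : z < lam) :
    ∫⁻ q, (if q.1 < q.2 then ENNReal.ofReal (Real.exp (z * q.1)) else 0) ∂pairLaw lam k θ =
      ENNReal.ofReal ((1 + θ * (lam - z)) ^ (-k)) := by
  have := isProbabilityMeasure_expMeasure hlam
  have h := lintegral_pairLaw_shift hlam hk hθ (f := fun _ => 1)
    (g := fun s => ENNReal.ofReal (Real.exp (z * s))) measurable_const (by fun_prop)
  rw [lintegral_gammaMeasure_tilted hlam hk hθ hz] at h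
  simpa using h

lemma pairLaw_lt (hlam : 0 < lam) (hk : 0 < k) (hθ : 0 < θ) :
    pairLaw lam k θ {q | q.1 < q.2} = ENNReal.ofReal ((1 + lam * θ) ^ (-k)) := by
  -- The last `hlam`, read as `0 < lam`, selects `z = 0`.
  have h := lintegral_pairLaw_success hlam hk hθ hlam
  rw [← lintegral_indicator_one measurableSet_lt_pair]
  simpa [Set.indicator_apply, mul_comm θ] using h

lemma rpow_neg_lt_one {a : ℝ} (hk : 0 < k) (ha : 0 < a) : (1 + a) ^ (-k) < 1 :=
  Real.rpow_lt_one_of_one_lt_of_neg (by linarith) (by linarith)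

/-- Complement of the success part: there `exp (z x) = exp (z s) * exp (z (x - s))` factorizes, and
the integral of `exp (z x)` over both events is known. All terms are finite, so they may be
subtracted. -/
lemma lintegral_pairLaw_failure (hlam : 0 < lam) (hk : 0 < k) (hθ : 0 < θ) {z : ℝ}
    (hz : z < lam) :
    ∫⁻ q, (if q.1 < q.2 then 0 else ENNReal.ofReal (Real.exp (z * q.2))) ∂pairLaw lam k θ =
      ENNReal.ofReal (lam / (lam - z) * (1 - (1 + θ * (lam - z)) ^ (-k))) := by
  have hl : 0 < lam - z := by linarith
  have hlt : (1 + θ * (lam - z)) ^ (-k) < 1 := rpow_neg_lt_one hk (by positivity)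
  have h := lintegral_pairLaw_shift hlam hk hθ (f := fun x => ENNReal.ofReal (Real.exp (z * x)))
    (g := fun s => ENNReal.ofReal (Real.exp (z * s))) (by fun_prop) (by fun_prop)
  rw [lintegral_gammaMeasure_tilted hlam hk hθ hz, lintegral_exp_expMeasure hlam hz,
    ← ENNReal.ofReal_mul (by positivity)] at h
  have hs := lintegral_pairLaw_snd hlam hk hθ
    (f := fun x => ENNReal.ofReal (Real.exp (z * x))) (by fun_prop)
  rw [lintegral_exp_expMeasure hlam hz] at hs
  have hadd : ∫⁻ q, (if q.1 < q.2 then 0 else ENNReal.ofReal (Real.exp (z * q.2)))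
      ∂pairLaw lam k θ + ENNReal.ofReal ((1 + θ * (lam - z)) ^ (-k) * (lam / (lam - z))) =
      ENNReal.ofReal (lam / (lam - z)) := by
    rw [← h, ← hs, ← lintegral_add_left (measurable_ite_lt measurable_const (by fun_prop))]
    refine lintegral_congr fun q => ?_
    split_ifs
    · rw [zero_add, ← ENNReal.ofReal_mul (by positivity), ← Real.exp_add]; ring_nf
    · simp
  rw [ENNReal.eq_sub_of_add_eq ENNReal.ofReal_ne_top hadd,
    ← ENNReal.ofReal_sub _ (by positivity)]
  congr 1
  ring

lemma lintegral_pairLaw_excess (hlam : 0 < lam) (hk : 0 < k) (hθ : 0 < θ) :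
    ∫⁻ q, (if q.1 < q.2 then ENNReal.ofReal (q.2 - q.1) else 0) ∂pairLaw lam k θ =
      ENNReal.ofReal ((1 + lam * θ) ^ (-k) / lam) := by
  have := isProbabilityMeasure_gammaMeasure hk (show 0 < (1 + lam * θ) / θ by positivity)
  have h := lintegral_pairLaw_shift hlam hk hθ (f := fun x => ENNReal.ofReal x)
    (g := fun _ => 1) (by fun_prop) measurable_const
  rw [expMeasure, lintegral_id_gammaMeasure one_pos hlam] at h
  simp only [one_mul, lintegral_const, measure_univ, mul_one] at h
  rw [h, ← ENNReal.ofReal_mul (by positivity), mul_one_div]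

end pair

/-! ### Sample paths: successes -/

lemma arrival_succ (x : ℕ → ℝ) (n : ℕ) : arrival x (n + 1) = arrival x n + x (n + 1) :=
  Finset.sum_range_succ _ _

lemma delivered_iff {x s : ℕ → ℝ} {n : ℕ} : Delivered x s n ↔ s n < x (n + 1) := by
  rw [Delivered, reception, arrival_succ, add_lt_add_iff_left]

lemma arrival_add (x : ℕ → ℝ) (n m : ℕ) :
    arrival x (n + m) = arrival x n + ∑ l ∈ Finset.range m, x (n + l + 1) := by
  induction m with
  | zero => simp
  | succ m ih => rw [← add_assoc, arrival_succ, ih, Finset.sum_range_succ, add_assoc]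

/-! ### Information available at arrivals, and independence of the next pair -/

section independence

variable {Ω : Type*} {X S : ℕ → Ω → ℝ}

/-- The service time of packet `n` together with the interarrival time which follows its arrival. -/
def pair (X S : ℕ → Ω → ℝ) (n : ℕ) (ω : Ω) : ℝ × ℝ := (S n ω, X (n + 1) ω)

/-- The indices of the input variables known at the arrival of packet `n`. -/
def historyIndex (n : ℕ) : Set (ℕ ⊕ ℕ) := {j | Sum.elim (· ≤ n) (· < n) j}

/-- The sigma-algebra of the information available at the arrival of packet `n`. -/
abbrev history (X S : ℕ → Ω → ℝ) (n : ℕ) : MeasurableSpace Ω :=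
  ⨆ j ∈ historyIndex n, MeasurableSpace.comap (Sum.elim X S j) inferInstance

lemma measurable_history {n : ℕ} {j : ℕ ⊕ ℕ} (hj : j ∈ historyIndex n) :
    Measurable[history X S n] (Sum.elim X S j) :=
  measurable_iff_comap_le.2 (le_iSup₂_of_le j hj le_rfl)

lemma history_mono : Monotone (history X S) := by
  intro m n hmn
  refine biSup_mono fun j hj => ?_
  rcases j with j | j
  · exact le_trans (show j ≤ m from hj) hmn
  · exact lt_of_lt_of_le (show j < m from hj) hmn

lemma measurable_pair_history {m n : ℕ} (hmn : m < n) :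
    Measurable[history X S n] (pair X S m) :=
  Measurable.prodMk (m := history X S n) (measurable_history (j := Sum.inr m) hmn)
    (measurable_history (j := Sum.inl (m + 1)) hmn)

lemma measurable_delivered_history {m n : ℕ} (hmn : m < n) :
    MeasurableSet[history X S n] {ω | Delivered (path X ω) (path S ω) m} := by
  have h := measurable_pair_history (X := X) (S := S) hmn measurableSet_lt_pair
  convert h using 1
  ext ω
  exact delivered_iff

open scoped Classical in
lemma measurable_count_history (n : ℕ) :
    Measurable[history X S n] fun ω => Nat.count (Delivered (path X ω) (path S ω)) n := by
  have h : ∀ m ≤ n,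
      Measurable[history X S n] fun ω => Nat.count (Delivered (path X ω) (path S ω)) m := by
    intro m
    induction m with
    | zero => intro _; simp only [Nat.count_zero]; exact measurable_const
    | succ m ih =>
      intro hm
      simp only [Nat.count_succ]
      exact Measurable.add (ih (by omega))
        (Measurable.ite (measurable_delivered_history hm) measurable_const measurable_const)
  exact h n le_rfl

lemma measurable_history_mul_prod {n : ℕ} {F : Ω → ℝ≥0∞}
    (hF : Measurable[history X S n] F) {φ : ℝ × ℝ → ℝ≥0∞} (hφ : Measurable φ) (m : ℕ) :
    Measurable[history X S (n + m)]
      fun ω => F ω * ∏ l ∈ Finset.range m, φ (pair X S (n + l) ω) := by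
  refine Measurable.mul (hF.mono (history_mono (Nat.le_add_right n m)) le_rfl) ?_
  refine Finset.measurable_fun_prod _ fun l hl => ?_
  exact hφ.comp (measurable_pair_history (by simpa using hl))

namespace PoissonGammaInput

variable [MeasurableSpace Ω] {μ : Measure Ω} {lam k θ : ℝ}
  (hXS : PoissonGammaInput μ lam k θ X S)
include hXS

lemma measurable_elim (j : ℕ ⊕ ℕ) : Measurable (Sum.elim X S j) := by
  rcases j with j | j
  · exact hXS.measurable_interarrival j
  · exact hXS.measurable_service j

lemma history_le (n : ℕ) : history X S n ≤ ‹MeasurableSpace Ω› :=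
  iSup₂_le fun j _ => (hXS.measurable_elim j).comap_le

lemma measurable_pair (n : ℕ) : Measurable (pair X S n) :=
  (hXS.measurable_service n).prodMk (hXS.measurable_interarrival (n + 1))

/-- The past at arrival `n` involves `X 0, …, X n` and `S 0, …, S (n - 1)`; pair `n` involves `S n`
and `X (n + 1)`. The index sets are disjoint. -/
lemma indepFun_pair {β : Type*} [MeasurableSpace β] {n : ℕ} {F : Ω → β}
    (hF : Measurable[history X S n] F) : IndepFun F (pair X S n) μ := by
  have h := indep_iSup_of_disjoint (fun j => (hXS.measurable_elim j).comap_le) hXS.indep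
    (S := historyIndex n) (T := {Sum.inr n, Sum.inl (n + 1)}) (by
      rw [Set.disjoint_left]
      rintro (j | j) hj hj'
      · simp only [historyIndex, Set.mem_ofPred_eq, Sum.elim_inl] at hj
        simp at hj'
        omega
      · simp only [historyIndex, Set.mem_ofPred_eq, Sum.elim_inr] at hj
        simp at hj'
        omega)
  refine indep_of_indep_of_le_left (indep_of_indep_of_le_right h ?_) hF.comap_le
  rw [← measurable_iff_comap_le]
  refine Measurable.prodMk ?_ ?_
  · exact measurable_iff_comap_le.2 (le_iSup₂_of_le (Sum.inr n) (by simp) le_rfl)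
  · exact measurable_iff_comap_le.2 (le_iSup₂_of_le (Sum.inl (n + 1)) (by simp) le_rfl)

lemma indepFun_comp_pair {β γ : Type*} [MeasurableSpace β] [MeasurableSpace γ] {n : ℕ} {F : Ω → β}
    (hF : Measurable[history X S n] F) {φ : ℝ × ℝ → γ} (hφ : Measurable φ) :
    IndepFun F (fun ω => φ (pair X S n ω)) μ :=
  (hXS.indepFun_pair hF).comp measurable_id hφ

lemma map_pair [IsProbabilityMeasure μ] (n : ℕ) : μ.map (pair X S n) = pairLaw lam k θ := by
  have h : IndepFun (S n) (X (n + 1)) μ :=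
    hXS.indep.indepFun (i := Sum.inr n) (j := Sum.inl (n + 1)) (by simp)
  rw [pairLaw, ← hXS.law_service n, ← hXS.law_interarrival (n + 1)]
  exact (indepFun_iff_map_prod_eq_prod_map_map (hXS.measurable_service n).aemeasurable
    (hXS.measurable_interarrival (n + 1)).aemeasurable).1 h

lemma lintegral_pair [IsProbabilityMeasure μ] (n : ℕ) {φ : ℝ × ℝ → ℝ≥0∞} (hφ : Measurable φ) :
    ∫⁻ ω, φ (pair X S n ω) ∂μ = ∫⁻ q, φ q ∂pairLaw lam k θ := by
  rw [← hXS.map_pair n, lintegral_map hφ (hXS.measurable_pair n)]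

lemma lintegral_history_mul [IsProbabilityMeasure μ] {n : ℕ} {F : Ω → ℝ≥0∞}
    (hF : Measurable[history X S n] F) {φ : ℝ × ℝ → ℝ≥0∞} (hφ : Measurable φ) :
    ∫⁻ ω, F ω * φ (pair X S n ω) ∂μ = (∫⁻ ω, F ω ∂μ) * ∫⁻ q, φ q ∂pairLaw lam k θ := by
  rw [← hXS.lintegral_pair n hφ]
  exact lintegral_mul_eq_lintegral_mul_lintegral_of_indepFun''
    (hF.mono (hXS.history_le n) le_rfl).aemeasurable
    (hφ.comp (hXS.measurable_pair n)).aemeasurable (hXS.indepFun_comp_pair hF hφ)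

/-- The factors are peeled off from the last one, each being independent of the past that contains
all earlier ones. -/
lemma lintegral_history_mul_prod [IsProbabilityMeasure μ] {n : ℕ} {F : Ω → ℝ≥0∞}
    (hF : Measurable[history X S n] F) {φ : ℝ × ℝ → ℝ≥0∞} (hφ : Measurable φ) (m : ℕ) :
    ∫⁻ ω, F ω * ∏ l ∈ Finset.range m, φ (pair X S (n + l) ω) ∂μ =
      (∫⁻ ω, F ω ∂μ) * (∫⁻ q, φ q ∂pairLaw lam k θ) ^ m := by
  induction m with
  | zero => simp
  | succ m ih =>
    simp only [Finset.prod_range_succ, ← mul_assoc]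
    rw [hXS.lintegral_history_mul (measurable_history_mul_prod hF hφ m) hφ, ih, pow_succ,
      mul_assoc]

lemma ae_pos_service : ∀ᵐ ω ∂μ, ∀ n, 0 < S n ω := by
  refine ae_all_iff.2 fun n => ?_
  have h := ae_pos_gammaMeasure k (1 / θ)
  rw [← hXS.law_service n] at h
  exact ae_of_ae_map (hXS.measurable_service n).aemeasurable h

lemma ae_pos_interarrival : ∀ᵐ ω ∂μ, ∀ n, 0 < X n ω := by
  refine ae_all_iff.2 fun n => ?_
  have h := ae_pos_gammaMeasure 1 lam
  rw [← expMeasure, ← hXS.law_interarrival n] at h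
  exact ae_of_ae_map (hXS.measurable_interarrival n).aemeasurable h

/-- Strong law of large numbers for functions of the service times and interarrival times. -/
lemma ae_tendsto_average_pair [IsProbabilityMeasure μ] {φ : ℝ × ℝ → ℝ} (hφ : Measurable φ)
    (hint : Integrable φ (pairLaw lam k θ)) :
    ∀ᵐ ω ∂μ, Tendsto (fun n : ℕ => (∑ j ∈ Finset.range n, φ (pair X S j ω)) / n) atTop
      (𝓝 (∫ q, φ q ∂pairLaw lam k θ)) := by
  have hmeas := fun n => hφ.comp (hXS.measurable_pair n)
  have h := strong_law_ae_real (μ := μ) (fun n ω => φ (pair X S n ω)) ?_ ?_ ?_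
  · have e : μ[fun ω => φ (pair X S 0 ω)] = ∫ q, φ q ∂pairLaw lam k θ := by
      rw [← hXS.map_pair 0, integral_map (hXS.measurable_pair 0).aemeasurable
        hφ.aestronglyMeasurable]
    rwa [e] at h
  · rw [← hXS.map_pair 0] at hint
    exact hint.comp_measurable (hXS.measurable_pair 0)
  -- The strong law requires only pairwise independence; for `m < n`, pair `m` belongs to the past
  -- at arrival `n`.
  · have hlt : ∀ {m n : ℕ}, m < n →
        IndepFun (fun ω => φ (pair X S m ω)) (fun ω => φ (pair X S n ω)) μ := fun hmn =>
      hXS.indepFun_comp_pair (hφ.comp (measurable_pair_history hmn)) hφ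
    intro m n hmn
    rcases hmn.lt_or_gt with h | h
    · exact hlt h
    · exact (hlt h).symm
  · intro n
    have hid : IdentDistrib (pair X S n) (pair X S 0) μ μ :=
      ⟨(hXS.measurable_pair n).aemeasurable, (hXS.measurable_pair 0).aemeasurable, by
        rw [hXS.map_pair, hXS.map_pair]⟩
    exact hid.comp hφ

end PoissonGammaInput

end independence

/-! ### The law of a system time and of the next interdeparture time -/

/-- Contribution of a successful packet: a function of the system time and the exponential of
the time from its reception to the next arrival. -/
noncomputable def firstWeight (g : ℝ → ℝ≥0∞) (z : ℝ) (q : ℝ × ℝ) : ℝ≥0∞ :=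
  if q.1 < q.2 then g q.1 * ENNReal.ofReal (Real.exp (z * (q.2 - q.1))) else 0

/-- Contribution of an unsuccessful packet: the exponential of the next interarrival time. -/
noncomputable def middleWeight (z : ℝ) (q : ℝ × ℝ) : ℝ≥0∞ :=
  if q.1 < q.2 then 0 else ENNReal.ofReal (Real.exp (z * q.2))

/-- Contribution of the next successful packet: the exponential of its service time. -/
noncomputable def lastWeight (z : ℝ) (q : ℝ × ℝ) : ℝ≥0∞ :=
  if q.1 < q.2 then ENNReal.ofReal (Real.exp (z * q.1)) else 0

lemma measurable_firstWeight {g : ℝ → ℝ≥0∞} (hg : Measurable g) (z : ℝ) :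
    Measurable (firstWeight g z) :=
  measurable_ite_lt (by fun_prop) measurable_const

lemma measurable_middleWeight (z : ℝ) : Measurable (middleWeight z) :=
  measurable_ite_lt measurable_const (by fun_prop)

lemma measurable_lastWeight (z : ℝ) : Measurable (lastWeight z) :=
  measurable_ite_lt (by fun_prop) measurable_const

section paths

variable {x s : ℕ → ℝ}

open scoped Classical in
/-- Weight of the event that packet `n` is the successful packet number `i` and that exactly `m`
unsuccessful packets separate it from the next successful one. -/
noncomputable def cycleWeight (g : ℝ → ℝ≥0∞) (z : ℝ) (i : ℕ) (x s : ℕ → ℝ) (n m : ℕ) : ℝ≥0∞ :=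
  (if Nat.count (Delivered x s) n = i then 1 else 0) * firstWeight g z (s n, x (n + 1)) *
    (∏ l ∈ Finset.range m, middleWeight z (s (n + 1 + l), x (n + 1 + l + 1))) *
      lastWeight z (s (n + 1 + m), x (n + 1 + m + 1))

lemma delivered_successIndex (hinf : {n | Delivered x s n}.Infinite) (i : ℕ) :
    Delivered x s (successIndex x s i) :=
  Nat.nth_mem_of_infinite hinf i

lemma successIndex_strictMono (hinf : {n | Delivered x s n}.Infinite) :
    StrictMono (successIndex x s) :=
  Nat.nth_strictMono hinf

lemma not_delivered_of_between (hinf : {n | Delivered x s n}.Infinite) {i n : ℕ}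
    (h1 : successIndex x s i < n) (h2 : n < successIndex x s (i + 1)) : ¬ Delivered x s n := by
  classical
  intro hn
  have hc : successIndex x s (Nat.count (Delivered x s) n) = n := Nat.nth_count hn
  rw [← hc] at h1 h2
  have h1' := (successIndex_strictMono hinf).lt_iff_lt.1 h1
  have h2' := (successIndex_strictMono hinf).lt_iff_lt.1 h2
  omega

open scoped Classical in
-- The weights vanish unless `n` and `n + 1 + m` are consecutive successes with `n` the one numbered
-- `i`. The double sum therefore has a single term, whose exponents add up to `z` times the
-- interdeparture time.
lemma tsum_cycleWeight (hinf : {n | Delivered x s n}.Infinite) (g : ℝ → ℝ≥0∞) (z : ℝ) (i : ℕ) :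
    ∑' n, ∑' m, cycleWeight g z i x s n m =
      g (systemTime x s i) * ENNReal.ofReal (Real.exp (z * interdeparture x s i)) := by
  set a := successIndex x s i with ha
  set b := successIndex x s (i + 1) with hb
  have hab : a < b := successIndex_strictMono hinf (Nat.lt_succ_self i)
  have hda : Delivered x s a := delivered_successIndex hinf i
  have hdb : Delivered x s b := delivered_successIndex hinf (i + 1)
  have hnot : ∀ n, a < n → n < b → ¬ Delivered x s n := fun n h1 h2 =>
    not_delivered_of_between hinf h1 h2
  -- Between the successes `a` and `b` there are `b - a - 1` failures.
  rw [tsum_eq_single a, tsum_eq_single (b - a - 1)]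
  · have hb' : a + 1 + (b - a - 1) = b := by omega
    have hcount : Nat.count (Delivered x s) a = i := Nat.count_nth_of_infinite hinf i
    have hmid : ∀ l ∈ Finset.range (b - a - 1),
        middleWeight z (s (a + 1 + l), x (a + 1 + l + 1)) =
          ENNReal.ofReal (Real.exp (z * x (a + 1 + l + 1))) := by
      intro l hl
      have := hnot (a + 1 + l) (by omega) (by have := Finset.mem_range.1 hl; omega)
      rw [delivered_iff] at this
      exact if_neg this
    rw [cycleWeight, Finset.prod_congr rfl hmid, hb', firstWeight, lastWeight,
      if_pos hcount, if_pos (delivered_iff.1 hda),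
      if_pos (delivered_iff.1 hdb),
      ← ENNReal.ofReal_prod_of_nonneg (fun _ _ => (Real.exp_pos _).le), ← Real.exp_sum, one_mul,
      mul_assoc, mul_assoc, ← ENNReal.ofReal_mul (Real.exp_pos _).le,
      ← ENNReal.ofReal_mul (Real.exp_pos _).le, ← Real.exp_add, ← Real.exp_add]
    have h1 : systemTime x s i = s a := by
      rw [systemTime, departure, reception, ← ha]; ring
    have h2 : interdeparture x s i =
        (x (a + 1) - s a) + (∑ l ∈ Finset.range (b - a - 1), x (a + 1 + l + 1)) + s b := by
      have hsplit := arrival_add x (a + 1) (b - a - 1)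
      rw [hb', arrival_succ] at hsplit
      rw [interdeparture, departure, departure, reception, reception, ← ha, ← hb, hsplit]
      ring
    rw [h1, h2, ← Finset.mul_sum]
    congr 3
    ring
  · intro m hm
    rcases lt_or_gt_of_ne hm with h | h
    · have := hnot (a + 1 + m) (by omega) (by omega)
      rw [delivered_iff] at this
      simp [cycleWeight, lastWeight, this]
    · have hz : middleWeight z (s (a + 1 + (b - a - 1)), x (a + 1 + (b - a - 1) + 1)) = 0 := by
        rw [show a + 1 + (b - a - 1) = b by omega]
        exact if_pos (delivered_iff.1 hdb)
      have hprod : ∏ l ∈ Finset.range m,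
          middleWeight z (s (a + 1 + l), x (a + 1 + l + 1)) = 0 :=
        Finset.prod_eq_zero (Finset.mem_range.2 h) hz
      simp [cycleWeight, hprod]
  · intro n hn
    refine ENNReal.tsum_eq_zero.2 fun m => ?_
    by_cases hc : Nat.count (Delivered x s) n = i
    · by_cases hd : Delivered x s n
      · refine absurd ?_ hn
        rw [ha, successIndex, ← hc, Nat.nth_count hd]
      · rw [delivered_iff] at hd
        simp [cycleWeight, firstWeight, hd]
    · simp [cycleWeight, hc]

end paths

namespace PoissonGammaInput

variable {Ω : Type*} [MeasurableSpace Ω] {μ : Measure Ω} [IsProbabilityMeasure μ]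
  {lam k θ : ℝ} {X S : ℕ → Ω → ℝ} (hlam : 0 < lam) (hk : 0 < k) (hθ : 0 < θ)
  (hXS : PoissonGammaInput μ lam k θ X S)
include hlam hk hθ hXS

open scoped Classical in
/-- The success frequency. -/
lemma ae_tendsto_count :
    ∀ᵐ ω ∂μ, Tendsto (fun n : ℕ => (Nat.count (Delivered (path X ω) (path S ω)) n : ℝ) / n) atTop
      (𝓝 ((1 + lam * θ) ^ (-k))) := by
  have := isProbabilityMeasure_pairLaw hlam hk hθ
  have hm : Measurable ({q : ℝ × ℝ | q.1 < q.2}.indicator (1 : ℝ × ℝ → ℝ)) :=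
    measurable_one.indicator measurableSet_lt_pair
  have h := hXS.ae_tendsto_average_pair hm
    ((integrable_const (1 : ℝ)).indicator measurableSet_lt_pair)
  rw [integral_indicator_one measurableSet_lt_pair, Measure.real, pairLaw_lt hlam hk hθ,
    ENNReal.toReal_ofReal (by positivity)] at h
  filter_upwards [h] with ω hω
  convert hω using 3 with n
  induction n with
  | zero => simp
  | succ n ih =>
    rw [Nat.count_succ, Finset.sum_range_succ, ← ih]
    simp only [delivered_iff, pair, path, Set.indicator_apply, Set.mem_ofPred_eq, Pi.one_apply]
    push_cast
    rfl

/-- Finitely many successes would force success frequency zero, but its limit is positive. -/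
lemma ae_infinite_delivered :
    ∀ᵐ ω ∂μ, {n | Delivered (path X ω) (path S ω) n}.Infinite := by
  classical
  filter_upwards [hXS.ae_tendsto_count hlam hk hθ] with ω hω hfin
  have hbd : ∀ n, (Nat.count (Delivered (path X ω) (path S ω)) n : ℝ) ≤ hfin.toFinset.card :=
    fun n => by exact_mod_cast Nat.count_le_card hfin n
  have h0 : Tendsto (fun n : ℕ => (Nat.count (Delivered (path X ω) (path S ω)) n : ℝ) / n) atTop
      (𝓝 0) :=
    squeeze_zero (fun n => by positivity)
      (fun n => div_le_div_of_nonneg_right (hbd n) (Nat.cast_nonneg n))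
      (tendsto_const_div_atTop_nhds_zero_nat _)
  have := tendsto_nhds_unique hω h0
  have : (0 : ℝ) < (1 + lam * θ) ^ (-k) := by positivity
  linarith

lemma measure_delivered (n : ℕ) :
    μ {ω | Delivered (path X ω) (path S ω) n} = ENNReal.ofReal ((1 + lam * θ) ^ (-k)) := by
  rw [← pairLaw_lt hlam hk hθ, ← hXS.map_pair n,
    Measure.map_apply (hXS.measurable_pair n) measurableSet_lt_pair]
  congr 1
  ext ω
  exact delivered_iff

lemma effectiveRate_eq (n : ℕ) : effectiveRate μ lam X S n = lam * (1 + lam * θ) ^ (-k) := by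
  rw [effectiveRate, Measure.real, hXS.measure_delivered hlam hk hθ n,
    ENNReal.toReal_ofReal (by positivity)]

open scoped Classical in
-- Each summand times the success probability is the probability that success number `i` is packet
-- `n`; these events partition the space up to a null set. This normalizes the sum over positions
-- without computing the law of the position.
lemma tsum_measure_count (i : ℕ) :
    (∑' n, ∫⁻ ω, (if Nat.count (Delivered (path X ω) (path S ω)) n = i then 1 else 0) ∂μ) *
      ENNReal.ofReal ((1 + lam * θ) ^ (-k)) = 1 := by
  have hφ : Measurable fun q : ℝ × ℝ => if q.1 < q.2 then (1 : ℝ≥0∞) else 0 :=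
    measurable_ite_lt measurable_const measurable_const
  have hF : ∀ n, Measurable[history X S n]
      fun ω => if Nat.count (Delivered (path X ω) (path S ω)) n = i then (1 : ℝ≥0∞) else 0 :=
    fun n => Measurable.ite (measurable_count_history n (measurableSet_singleton i))
      measurable_const measurable_const
  have hp : ∫⁻ q, (if q.1 < q.2 then (1 : ℝ≥0∞) else 0) ∂pairLaw lam k θ =
      ENNReal.ofReal ((1 + lam * θ) ^ (-k)) := by
    have h := lintegral_pairLaw_success hlam hk hθ hlam
    simpa [mul_comm θ] using h
  rw [← hp, ← ENNReal.tsum_mul_right]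
  simp only [← hXS.lintegral_history_mul (hF _) hφ]
  have hmeas : ∀ n, AEMeasurable (fun ω =>
      (if Nat.count (Delivered (path X ω) (path S ω)) n = i then (1 : ℝ≥0∞) else 0) *
        if (pair X S n ω).1 < (pair X S n ω).2 then 1 else 0) μ := fun n =>
    (((hF n).mono (hXS.history_le n) le_rfl).mul (hφ.comp (hXS.measurable_pair n))).aemeasurable
  rw [← lintegral_tsum hmeas]
  refine (lintegral_congr_ae (g := fun _ => 1) ?_).trans (by simp)
  filter_upwards [hXS.ae_infinite_delivered hlam hk hθ] with ω hinf
  rw [tsum_eq_single (successIndex (path X ω) (path S ω) i)]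
  · have hd := delivered_iff.1 (delivered_successIndex hinf i)
    have hc : Nat.count (Delivered (path X ω) (path S ω))
      (successIndex (path X ω) (path S ω) i) = i := Nat.count_nth_of_infinite hinf i
    rw [if_pos hc, one_mul]
    exact if_pos hd
  · intro n hn
    by_cases hc : Nat.count (Delivered (path X ω) (path S ω)) n = i
    · by_cases hd : Delivered (path X ω) (path S ω) n
      · refine absurd ?_ hn
        rw [successIndex, ← hc, Nat.nth_count hd]
      · rw [delivered_iff] at hd
        have : ¬ (pair X S n ω).1 < (pair X S n ω).2 := hd
        simp [this]
    · simp [hc]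

omit hlam hk hθ in
open scoped Classical in
-- The factors concern, in order, the past at arrival `n`, pair `n`, the next `m` pairs and the pair
-- after them, so the integral is a product.
lemma lintegral_cycleWeight {g : ℝ → ℝ≥0∞} (hg : Measurable g) (z : ℝ) (i n m : ℕ) :
    Measurable (fun ω => cycleWeight g z i (path X ω) (path S ω) n m) ∧
    ∫⁻ ω, cycleWeight g z i (path X ω) (path S ω) n m ∂μ =
      (∫⁻ ω, (if Nat.count (Delivered (path X ω) (path S ω)) n = i then 1 else 0) ∂μ) *
        (∫⁻ q, firstWeight g z q ∂pairLaw lam k θ) *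
        (∫⁻ q, middleWeight z q ∂pairLaw lam k θ) ^ m *
        ∫⁻ q, lastWeight z q ∂pairLaw lam k θ := by
  have hF : Measurable[history X S n]
      fun ω => if Nat.count (Delivered (path X ω) (path S ω)) n = i then (1 : ℝ≥0∞) else 0 :=
    Measurable.ite (measurable_count_history n (measurableSet_singleton i))
      measurable_const measurable_const
  have h1 := hXS.lintegral_history_mul hF (measurable_firstWeight hg z)
  have hF1 : Measurable[history X S (n + 1)]
      fun ω => (if Nat.count (Delivered (path X ω) (path S ω)) n = i then (1 : ℝ≥0∞) else 0) *
        firstWeight g z (pair X S n ω) :=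
    Measurable.mul (hF.mono (history_mono (Nat.le_succ n)) le_rfl)
      ((measurable_firstWeight hg z).comp (measurable_pair_history (Nat.lt_succ_self n)))
  have h2 := hXS.lintegral_history_mul_prod hF1 (measurable_middleWeight z) m
  have hF2 := measurable_history_mul_prod hF1 (measurable_middleWeight z) m
  have h3 := hXS.lintegral_history_mul hF2 (measurable_lastWeight z)
  rw [h2, h1] at h3
  exact ⟨(hF2.mono (hXS.history_le _) le_rfl).mul
    ((measurable_lastWeight z).comp (hXS.measurable_pair _)), h3⟩

/-- Joint transform of a system time and of the next interdeparture time. -/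
lemma lintegral_systemTime_interdeparture {g : ℝ → ℝ≥0∞} (hg : Measurable g) {z : ℝ}
    (hz : z < lam) (hz' : z * (1 + θ * (lam - z)) ^ k < lam) (i : ℕ) :
    ∫⁻ ω, g (systemTime (path X ω) (path S ω) i) *
        ENNReal.ofReal (Real.exp (z * interdeparture (path X ω) (path S ω) i)) ∂μ =
      (∫⁻ t, g t ∂gammaMeasure k ((1 + lam * θ) / θ)) *
        ENNReal.ofReal (lam / (lam - z * (1 + θ * (lam - z)) ^ k)) := by
  classical
  have hl : 0 < lam - z := by linarith
  have hR : 0 < (1 + θ * (lam - z)) ^ k := by positivity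
  have hw := hXS.tsum_measure_count hlam hk hθ i
  set w := ∑' n, ∫⁻ ω, (if Nat.count (Delivered (path X ω) (path S ω)) n = i then 1 else 0) ∂μ
  have e1 : ∫⁻ q, firstWeight g z q ∂pairLaw lam k θ =
      ENNReal.ofReal ((1 + lam * θ) ^ (-k)) *
        (∫⁻ t, g t ∂gammaMeasure k ((1 + lam * θ) / θ)) * ENNReal.ofReal (lam / (lam - z)) := by
    rw [← lintegral_exp_expMeasure hlam hz]
    exact lintegral_pairLaw_shift hlam hk hθ
      (f := fun x => ENNReal.ofReal (Real.exp (z * x))) (by fun_prop) hg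
  have e2 : ∫⁻ q, middleWeight z q ∂pairLaw lam k θ =
    ENNReal.ofReal (lam / (lam - z) * (1 - (1 + θ * (lam - z)) ^ (-k))) :=
    lintegral_pairLaw_failure hlam hk hθ hz
  have e3 : ∫⁻ q, lastWeight z q ∂pairLaw lam k θ =
    ENNReal.ofReal ((1 + θ * (lam - z)) ^ (-k)) := lintegral_pairLaw_success hlam hk hθ hz
  have hsum : ∫⁻ ω, g (systemTime (path X ω) (path S ω) i) *
        ENNReal.ofReal (Real.exp (z * interdeparture (path X ω) (path S ω) i)) ∂μ =
      ∫⁻ ω, ∑' n, ∑' m, cycleWeight g z i (path X ω) (path S ω) n m ∂μ := by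
    refine lintegral_congr_ae ?_
    filter_upwards [hXS.ae_infinite_delivered hlam hk hθ] with ω hinf
    exact (tsum_cycleWeight hinf g z i).symm
  have hmeas := fun n m => (hXS.lintegral_cycleWeight hg z i n m).1
  have hQ : (1 + θ * (lam - z)) ^ (-k) < 1 := rpow_neg_lt_one hk (by positivity)
  have hQ' : (1 + θ * (lam - z)) ^ (-k) = ((1 + θ * (lam - z)) ^ k)⁻¹ :=
    Real.rpow_neg (by positivity) _
  rw [hsum, lintegral_tsum fun n => (Measurable.tsum fun m => hmeas n m).aemeasurable]
  simp only [fun n => lintegral_tsum (μ := μ) fun m => (hmeas n m).aemeasurable,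
    fun n m => (hXS.lintegral_cycleWeight hg z i n m).2]
  -- The sum over `m` is geometric, and the sum over `n` becomes `w`, with `w * p = 1`.
  simp only [ENNReal.tsum_mul_right, ENNReal.tsum_mul_left, ENNReal.tsum_geometric]
  rw [e1, e2, e3]
  set r := lam / (lam - z) * (1 - (1 + θ * (lam - z)) ^ (-k)) with hr
  have hr1 : 1 - r = (lam * (1 + θ * (lam - z)) ^ (-k) - z) / (lam - z) := by
    rw [hr]; field_simp; ring
  -- This is where `hz'` enters: it says exactly that the ratio `r` of the series is less than one.
  have hpos : 0 < lam * (1 + θ * (lam - z)) ^ (-k) - z := by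
    rw [hQ']
    have : z < lam / (1 + θ * (lam - z)) ^ k := (lt_div_iff₀ hR).2 hz'
    rw [div_eq_mul_inv] at this
    linarith
  have hr1pos : 0 < 1 - r := by rw [hr1]; positivity
  have hr0 : 0 ≤ r := by
    rw [hr]; exact mul_nonneg (by positivity) (by linarith)
  have hsub : 1 - ENNReal.ofReal r = ENNReal.ofReal (1 - r) := by
    rw [ENNReal.ofReal_sub _ hr0, ENNReal.ofReal_one]
  rw [hsub, ← ENNReal.ofReal_inv_of_pos hr1pos]
  set G := ∫⁻ t, g t ∂gammaMeasure k ((1 + lam * θ) / θ)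
  set p := ENNReal.ofReal ((1 + lam * θ) ^ (-k))
  have hfin : lam / (lam - z * (1 + θ * (lam - z)) ^ k) =
      lam / (lam - z) * (1 - r)⁻¹ * (1 + θ * (lam - z)) ^ (-k) := by
    have h2 : lam - z * (1 + θ * (lam - z)) ^ k ≠ 0 := by linarith
    rw [hr1, hQ']
    rw [hQ'] at hpos
    have h3 := hpos.ne'
    have h4 : lam * ((1 + θ * (lam - z)) ^ k)⁻¹ - z =
      (lam - z * (1 + θ * (lam - z)) ^ k) / (1 + θ * (lam - z)) ^ k := by field_simp
    rw [h4]
    field_simp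
  rw [hfin, ENNReal.ofReal_mul (by positivity), ENNReal.ofReal_mul (by positivity)]
  calc _ = (w * p) * (G * (ENNReal.ofReal (lam / (lam - z)) * ENNReal.ofReal (1 - r)⁻¹ *
      ENNReal.ofReal ((1 + θ * (lam - z)) ^ (-k)))) := by ring
    _ = _ := by rw [hw, one_mul]

end PoissonGammaInput

/-! ### Moments of system times and interdeparture times -/

/-- The moment generating function of the interdeparture times. -/
noncomputable def interdepartureMGF (lam k θ z : ℝ) : ℝ :=
  lam / (lam - z * (1 + θ * (lam - z)) ^ k)

section transform

variable {lam k θ : ℝ}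

/-- Both constraints hold strictly and continuously at `0`; moments can therefore be read off as
derivatives at `0`. -/
lemma eventually_lt_nhds_zero (hlam : 0 < lam) (hθ : 0 < θ) :
    ∀ᶠ z in 𝓝 (0 : ℝ), z < lam ∧ z * (1 + θ * (lam - z)) ^ k < lam := by
  refine (eventually_lt_nhds hlam).and ?_
  have hc : ContinuousAt (fun z : ℝ => z * (1 + θ * (lam - z)) ^ k) 0 := by
    refine continuousAt_id.mul (ContinuousAt.rpow_const (by fun_prop) (Or.inl ?_))
    have : 0 < 1 + θ * (lam - 0) := by rw [sub_zero]; positivity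
    exact this.ne'
  exact hc.eventually_lt continuousAt_const (by simpa using hlam)

lemma hasDerivAt_interdepartureMGF (hθ : 0 < θ) {z : ℝ} (hz : z < lam)
    (hz' : z * (1 + θ * (lam - z)) ^ k < lam) :
    HasDerivAt (interdepartureMGF lam k θ)
      (lam * ((1 + θ * (lam - z)) ^ k - z * (k * θ * (1 + θ * (lam - z)) ^ (k - 1))) /
        (lam - z * (1 + θ * (lam - z)) ^ k) ^ 2) z := by
  have hpos : 0 < 1 + θ * (lam - z) := by
    have : 0 < lam - z := by linarith
    positivity
  have h1 : HasDerivAt (fun z : ℝ => 1 + θ * (lam - z)) (-θ) z := by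
    simpa using (((hasDerivAt_id z).const_sub lam).const_mul θ).const_add 1
  have h2 := h1.rpow_const (p := k) (Or.inl hpos.ne')
  have h3 := ((hasDerivAt_id z).mul h2).const_sub lam
  have h4 := (hasDerivAt_const z lam).div h3 (by
    simp only [id, Pi.mul_apply]
    linarith)
  refine h4.congr_deriv ?_
  simp only [id, Pi.mul_apply]
  congr 1
  ring

lemma hasDerivAt_interdepartureMGF_zero (hlam : 0 < lam) (hθ : 0 < θ) :
    HasDerivAt (interdepartureMGF lam k θ) ((1 + lam * θ) ^ k / lam) 0 := by
  refine (hasDerivAt_interdepartureMGF hθ hlam (by simpa using hlam)).congr_deriv ?_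
  rw [zero_mul, zero_mul, sub_zero, sub_zero, mul_comm θ]
  field_simp

lemma iteratedDeriv_two_interdepartureMGF (hlam : 0 < lam) (hθ : 0 < θ) :
    iteratedDeriv 2 (interdepartureMGF lam k θ) 0 =
      2 * (((1 + lam * θ) ^ k / lam) ^ 2 -
        k * θ / (1 + lam * θ) * ((1 + lam * θ) ^ k / lam)) := by
  have hev : deriv (interdepartureMGF lam k θ) =ᶠ[𝓝 0] fun z =>
      lam * ((1 + θ * (lam - z)) ^ k - z * (k * θ * (1 + θ * (lam - z)) ^ (k - 1))) /
        (lam - z * (1 + θ * (lam - z)) ^ k) ^ 2 := by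
    filter_upwards [eventually_lt_nhds_zero (k := k) hlam hθ] with z hz
    exact (hasDerivAt_interdepartureMGF hθ hz.1 hz.2).deriv
  have hpos : 0 < 1 + θ * (lam - 0) := by rw [sub_zero]; positivity
  have h1 : HasDerivAt (fun z : ℝ => 1 + θ * (lam - z)) (-θ) 0 := by
    simpa using (((hasDerivAt_id (0 : ℝ)).const_sub lam).const_mul θ).const_add 1
  have h2 := h1.rpow_const (p := k) (Or.inl hpos.ne')
  have h2' := h1.rpow_const (p := k - 1) (Or.inl hpos.ne')
  have hnum := (h2.sub ((hasDerivAt_id (0 : ℝ)).mul (h2'.const_mul (k * θ)))).const_mul lam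
  have hden := (((hasDerivAt_id (0 : ℝ)).mul h2).const_sub lam).pow 2
  have h := hnum.div hden (by simp [hlam.ne'])
  have h' : HasDerivAt (deriv (interdepartureMGF lam k θ)) _ 0 := h.congr_of_eventuallyEq hev
  rw [iteratedDeriv_succ, iteratedDeriv_one, h'.deriv]
  have e : (1 + lam * θ) ^ (k - 1) = (1 + lam * θ) ^ k / (1 + lam * θ) :=
    Real.rpow_sub_one (by positivity) k
  simp only [Pi.mul_apply, Pi.pow_apply, Pi.sub_apply, id, sub_zero, zero_mul, add_zero,
    one_mul, mul_comm θ lam, e]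
  field_simp
  ring

end transform

namespace PoissonGammaInput

section measurability

variable {Ω : Type*} [MeasurableSpace Ω] {μ : Measure Ω}
  {lam k θ : ℝ} {X S : ℕ → Ω → ℝ} (hXS : PoissonGammaInput μ lam k θ X S)
include hXS

lemma measurable_arrival (n : ℕ) : Measurable fun ω => arrival (path X ω) n :=
  Finset.measurable_fun_sum _ fun j _ => hXS.measurable_interarrival j

lemma measurable_successIndex (i : ℕ) :
    Measurable fun ω => successIndex (path X ω) (path S ω) i := by
  classical
  -- The value `0` needs separate treatment, since `Nat.nth` also returns `0` when there are too few
  -- successes; its preimage is obtained below as a complement.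
  have hpos : ∀ n, n ≠ 0 →
      MeasurableSet ((fun ω => successIndex (path X ω) (path S ω) i) ⁻¹' {n}) := by
    intro n hn
    have e : (fun ω => successIndex (path X ω) (path S ω) i) ⁻¹' {n} =
        {ω | Delivered (path X ω) (path S ω) n} ∩
          (fun ω => Nat.count (Delivered (path X ω) (path S ω)) n) ⁻¹' {i} := by
      ext ω
      simp only [Set.mem_preimage, Set.mem_singleton_iff, Set.mem_inter_iff, Set.mem_ofPred_eq]
      constructor
      · intro h
        have hlt : ∀ hf : (Set.ofPred (Delivered (path X ω) (path S ω))).Finite,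
            i < hf.toFinset.card := by
          intro hf
          by_contra hge
          exact hn (h.symm.trans (Nat.nth_of_card_le hf (not_lt.1 hge)))
        exact ⟨h ▸ Nat.nth_mem i hlt, h ▸ Nat.count_nth hlt⟩
      · rintro ⟨h1, h2⟩
        rw [successIndex, ← h2, Nat.nth_count h1]
    rw [e]
    exact ((hXS.history_le _) _ (measurable_delivered_history (Nat.lt_succ_self n))).inter
      ((hXS.history_le _) _ (measurable_count_history n (measurableSet_singleton i)))
  refine measurable_to_countable' fun n => ?_
  by_cases hn : n = 0
  · have e : (fun ω => successIndex (path X ω) (path S ω) i) ⁻¹' {n} =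
        (⋃ m ∈ {m : ℕ | m ≠ 0}, (fun ω => successIndex (path X ω) (path S ω) i) ⁻¹' {m})ᶜ := by
      ext ω
      simp only [hn, Set.mem_preimage, Set.mem_singleton_iff, Set.mem_compl_iff, Set.mem_iUnion,
        Set.mem_ofPred_eq]
      grind
    rw [e]
    exact (MeasurableSet.biUnion (Set.to_countable _) fun m hm => hpos m hm).compl
  · exact hpos n hn

lemma measurable_departure (i : ℕ) : Measurable fun ω => departure (path X ω) (path S ω) i := by
  have h : Measurable fun q : Ω × ℕ => reception (path X q.1) (path S q.1) q.2 :=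
    measurable_from_prod_countable_left fun n =>
      (hXS.measurable_arrival n).add (hXS.measurable_service n)
  exact h.comp (measurable_id.prodMk (hXS.measurable_successIndex i))

lemma measurable_systemTime (i : ℕ) :
    Measurable fun ω => systemTime (path X ω) (path S ω) i := by
  have h : Measurable fun q : Ω × ℕ => arrival (path X q.1) q.2 :=
    measurable_from_prod_countable_left fun n => hXS.measurable_arrival n
  exact (hXS.measurable_departure i).sub
    (h.comp (measurable_id.prodMk (hXS.measurable_successIndex i)))

lemma measurable_interdeparture (i : ℕ) :
    Measurable fun ω => interdeparture (path X ω) (path S ω) i :=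
  (hXS.measurable_departure (i + 1)).sub (hXS.measurable_departure i)

end measurability

variable {Ω : Type*} [MeasurableSpace Ω] {μ : Measure Ω} [IsProbabilityMeasure μ]
  {lam k θ : ℝ} {X S : ℕ → Ω → ℝ} (hlam : 0 < lam) (hk : 0 < k) (hθ : 0 < θ)
  (hXS : PoissonGammaInput μ lam k θ X S)
include hlam hk hθ hXS

lemma hasLaw_systemTime (i : ℕ) :
    HasLaw (fun ω => systemTime (path X ω) (path S ω) i)
      (gammaMeasure k ((1 + lam * θ) / θ)) μ := by
  refine ⟨(hXS.measurable_systemTime i).aemeasurable, ?_⟩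
  refine Measure.ext fun A hA => ?_
  -- At `z = 0` the exponential factor is one, and an indicator `g` gives the law.
  have h := hXS.lintegral_systemTime_interdeparture hlam hk hθ
    (g := A.indicator 1) (measurable_one.indicator hA) hlam (by simpa using hlam) i
  rw [lintegral_indicator_one hA] at h
  simp only [zero_mul, Real.exp_zero, ENNReal.ofReal_one, mul_one, sub_zero, div_self hlam.ne']
    at h
  rw [← h, Measure.map_apply (hXS.measurable_systemTime i) hA,
    ← lintegral_indicator_one (hXS.measurable_systemTime i hA)]
  rfl

/-- The interdeparture time keeps its moment generating function, up to a constant factor, after a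
change of measure which depends on the system time only. -/
lemma mgf_interdeparture_withDensity {g : ℝ → ℝ≥0∞} (hg : Measurable g)
    (hfin : ∫⁻ t, g t ∂gammaMeasure k ((1 + lam * θ) / θ) ≠ ∞) {z : ℝ}
    (hz : z < lam) (hz' : z * (1 + θ * (lam - z)) ^ k < lam) (i : ℕ) :
    Integrable (fun ω => Real.exp (z * interdeparture (path X ω) (path S ω) i))
        (μ.withDensity fun ω => g (systemTime (path X ω) (path S ω) i)) ∧
      mgf (fun ω => interdeparture (path X ω) (path S ω) i)
        (μ.withDensity fun ω => g (systemTime (path X ω) (path S ω) i)) z =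
      (∫⁻ t, g t ∂gammaMeasure k ((1 + lam * θ) / θ)).toReal * interdepartureMGF lam k θ z := by
  have hY := hXS.measurable_interdeparture i
  have hT := hXS.measurable_systemTime i
  have hm : Measurable fun ω => Real.exp (z * interdeparture (path X ω) (path S ω) i) := by
    fun_prop
  have h : ∫⁻ ω, ENNReal.ofReal (Real.exp (z * interdeparture (path X ω) (path S ω) i))
      ∂(μ.withDensity fun ω => g (systemTime (path X ω) (path S ω) i)) =
      (∫⁻ t, g t ∂gammaMeasure k ((1 + lam * θ) / θ)) *
        ENNReal.ofReal (interdepartureMGF lam k θ z) := by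
    rw [lintegral_withDensity_eq_lintegral_mul _ (show Measurable fun ω =>
      g (systemTime (path X ω) (path S ω) i) from hg.comp hT) hm.ennreal_ofReal]
    exact hXS.lintegral_systemTime_interdeparture hlam hk hθ hg hz hz' i
  have hnn : 0 ≤ᵐ[μ.withDensity fun ω => g (systemTime (path X ω) (path S ω) i)]
      fun ω => Real.exp (z * interdeparture (path X ω) (path S ω) i) :=
    ae_of_all _ fun ω => (Real.exp_pos _).le
  have hM : 0 ≤ interdepartureMGF lam k θ z := div_nonneg hlam.le (by linarith)
  constructor
  · rw [← lintegral_ofReal_ne_top_iff_integrable hm.aestronglyMeasurable hnn, h]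
    exact ENNReal.mul_ne_top hfin ENNReal.ofReal_ne_top
  · rw [mgf, integral_eq_lintegral_of_nonneg_ae hnn hm.aestronglyMeasurable, h,
      ENNReal.toReal_mul, ENNReal.toReal_ofReal hM]

lemma mgf_interdeparture {z : ℝ} (hz : z < lam) (hz' : z * (1 + θ * (lam - z)) ^ k < lam)
    (i : ℕ) :
    Integrable (fun ω => Real.exp (z * interdeparture (path X ω) (path S ω) i)) μ ∧
      mgf (fun ω => interdeparture (path X ω) (path S ω) i) μ z = interdepartureMGF lam k θ z := by
  have := isProbabilityMeasure_gammaMeasure hk (show 0 < (1 + lam * θ) / θ by positivity)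
  have h := hXS.mgf_interdeparture_withDensity hlam hk hθ (g := fun _ => 1) measurable_const
    (by simp) hz hz' i
  have e : μ.withDensity (fun _ : Ω => (1 : ℝ≥0∞)) = μ := withDensity_one
  simpa [e] using h

lemma zero_mem_interior_integrableExpSet_interdeparture {g : ℝ → ℝ≥0∞} (hg : Measurable g)
    (hfin : ∫⁻ t, g t ∂gammaMeasure k ((1 + lam * θ) / θ) ≠ ∞) (i : ℕ) :
    0 ∈ interior (integrableExpSet (fun ω => interdeparture (path X ω) (path S ω) i)
      (μ.withDensity fun ω => g (systemTime (path X ω) (path S ω) i))) := by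
  rw [mem_interior_iff_mem_nhds]
  filter_upwards [eventually_lt_nhds_zero (k := k) hlam hθ] with z hz
  exact (hXS.mgf_interdeparture_withDensity hlam hk hθ hg hfin hz.1 hz.2 i).1

/-- The moment generating function is finite near `0`, so its second derivative there is the second
moment. -/
lemma moment_interdeparture_sq (i : ℕ) :
    Integrable (fun ω => interdeparture (path X ω) (path S ω) i ^ 2) μ ∧
      ∫ ω, interdeparture (path X ω) (path S ω) i ^ 2 ∂μ =
        2 * (((1 + lam * θ) ^ k / lam) ^ 2 -
          k * θ / (1 + lam * θ) * ((1 + lam * θ) ^ k / lam)) := by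
  have h0 : 0 ∈ interior
      (integrableExpSet (fun ω => interdeparture (path X ω) (path S ω) i) μ) := by
    rw [mem_interior_iff_mem_nhds]
    filter_upwards [eventually_lt_nhds_zero (k := k) hlam hθ] with z hz
    exact (hXS.mgf_interdeparture hlam hk hθ hz.1 hz.2 i).1
  refine ⟨integrable_pow_of_mem_interior_integrableExpSet h0 2, ?_⟩
  rw [← iteratedDeriv_two_interdepartureMGF hlam hθ]
  have hev : mgf (fun ω => interdeparture (path X ω) (path S ω) i) μ =ᶠ[𝓝 0]
      interdepartureMGF lam k θ := by
    filter_upwards [eventually_lt_nhds_zero (k := k) hlam hθ] with z hz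
    exact (hXS.mgf_interdeparture hlam hk hθ hz.1 hz.2 i).2
  rw [← hev.iteratedDeriv_eq 2, iteratedDeriv_mgf_zero h0]
  rfl

/-- Under the measure with density `T`, the transform of `Y` is multiplied by `E T` only; its
derivative at `0` is `E (T Y)`. -/
lemma moment_systemTime_mul_interdeparture (i : ℕ) :
    Integrable (fun ω => systemTime (path X ω) (path S ω) i *
        interdeparture (path X ω) (path S ω) i) μ ∧
      ∫ ω, systemTime (path X ω) (path S ω) i * interdeparture (path X ω) (path S ω) i ∂μ =
        k * θ / (1 + lam * θ) * ((1 + lam * θ) ^ k / lam) := by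
  have hr : 0 < (1 + lam * θ) / θ := by positivity
  have hG := lintegral_id_gammaMeasure hk hr
  have hg : Measurable fun t : ℝ => ENNReal.ofReal t := by fun_prop
  have hfin : ∫⁻ t, ENNReal.ofReal t ∂gammaMeasure k ((1 + lam * θ) / θ) ≠ ∞ := by
    rw [hG]; exact ENNReal.ofReal_ne_top
  have h0 := hXS.zero_mem_interior_integrableExpSet_interdeparture hlam hk hθ hg hfin i
  have hT := hXS.measurable_systemTime i
  have hpos : ∀ᵐ ω ∂μ, (ENNReal.ofReal (systemTime (path X ω) (path S ω) i)).toReal •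
      interdeparture (path X ω) (path S ω) i = systemTime (path X ω) (path S ω) i *
        interdeparture (path X ω) (path S ω) i := by
    filter_upwards [hXS.ae_pos_service] with ω hω
    have : 0 ≤ systemTime (path X ω) (path S ω) i := by
      rw [systemTime, departure, reception, add_sub_cancel_left]
      exact (hω _).le
    rw [ENNReal.toReal_ofReal this, smul_eq_mul]
  constructor
  · have h := integrable_of_mem_interior_integrableExpSet h0
    rw [integrable_withDensity_iff_integrable_smul' hT.ennreal_ofReal
      (ae_of_all _ fun _ => ENNReal.ofReal_lt_top)] at h
    exact h.congr hpos
  · rw [← integral_congr_ae hpos, ← integral_withDensity_eq_integral_toReal_smul hT.ennreal_ofReal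
      (ae_of_all _ fun _ => ENNReal.ofReal_lt_top), ← deriv_mgf_zero h0]
    have hev : mgf (fun ω => interdeparture (path X ω) (path S ω) i)
        (μ.withDensity fun ω => ENNReal.ofReal (systemTime (path X ω) (path S ω) i)) =ᶠ[𝓝 0]
        fun z => k * θ / (1 + lam * θ) * interdepartureMGF lam k θ z := by
      filter_upwards [eventually_lt_nhds_zero (k := k) hlam hθ] with z hz
      rw [(hXS.mgf_interdeparture_withDensity hlam hk hθ hg hfin hz.1 hz.2 i).2, hG,
        ENNReal.toReal_ofReal (by positivity), div_div_eq_mul_div]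
    rw [hev.deriv_eq, ((hasDerivAt_interdepartureMGF_zero hlam hθ).const_mul _).deriv]

end PoissonGammaInput

/-! ### Sample paths: the age process -/

open scoped Classical in
/-- The age at the generation time of packet `n`. -/
noncomputable def arrivalAge (x s : ℕ → ℝ) (a₀ : ℝ) : ℕ → ℝ
  | 0 => x 0 + a₀
  | n + 1 => x (n + 1) + if s n < x (n + 1) then 0 else arrivalAge x s a₀ n

section paths

variable {x s : ℕ → ℝ} {a₀ : ℝ}

lemma arrivalAge_of_delivered {n : ℕ} (h : Delivered x s n) :
    arrivalAge x s a₀ (n + 1) = x (n + 1) := by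
  rw [arrivalAge, if_pos (delivered_iff.1 h), add_zero]

lemma arrivalAge_of_not_delivered {n : ℕ} (h : ¬ Delivered x s n) :
    arrivalAge x s a₀ (n + 1) = x (n + 1) + arrivalAge x s a₀ n := by
  rw [arrivalAge, if_neg (mt delivered_iff.2 h)]

/-- The influence of the initial age ends with the first success. -/
lemma arrivalAge_congr {b₀ : ℝ} {j n : ℕ} (hj : Delivered x s j) (hn : j < n) :
    arrivalAge x s a₀ n = arrivalAge x s b₀ n := by
  induction n, hn using Nat.le_induction with
  | base => rw [arrivalAge_of_delivered hj, arrivalAge_of_delivered hj]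
  | succ n _ ih => rw [arrivalAge, arrivalAge, ih]

lemma arrival_nonneg (hx : ∀ n, 0 < x n) (n : ℕ) : 0 ≤ arrival x n :=
  Finset.sum_nonneg fun j _ => (hx j).le

lemma arrival_strictMono (hx : ∀ n, 0 < x n) : StrictMono (arrival x) :=
  strictMono_nat_of_lt_succ fun n => by rw [arrival_succ]; linarith [hx (n + 1)]

lemma arrival_lt_reception (hs : ∀ n, 0 < s n) (n : ℕ) : arrival x n < reception x s n := by
  rw [reception]; linarith [hs n]

lemma reception_lt_arrival (hx : ∀ n, 0 < x n) {j n : ℕ} (hj : Delivered x s j) (hjn : j < n) :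
    reception x s j < arrival x n :=
  lt_of_lt_of_le hj ((arrival_strictMono hx).monotone hjn)

/-- Links the recursion to the supremum in `newest`. A success of packet `n` adds a new maximum; a
failure leaves the set unchanged while arrival time and age both grow by `x (n + 1)`. -/
lemma isGreatest_generation (hx : ∀ n, 0 < x n) (ha : 0 ≤ a₀) (n : ℕ) :
    IsGreatest (insert (-a₀) {u | ∃ j, Delivered x s j ∧ j < n ∧ u = arrival x j})
      (arrival x n - arrivalAge x s a₀ n) := by
  induction n with
  | zero => simp [arrivalAge, arrival, isGreatest_singleton]
  | succ n ih =>
    by_cases hd : Delivered x s n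
    · rw [arrivalAge_of_delivered hd, arrival_succ, add_sub_cancel_right]
      refine ⟨Or.inr ⟨n, hd, n.lt_succ_self, rfl⟩, ?_⟩
      rintro u (rfl | ⟨j, -, hj, rfl⟩)
      · linarith [arrival_nonneg hx n]
      · exact (arrival_strictMono hx).monotone (Nat.lt_succ_iff.1 hj)
    · rw [arrivalAge_of_not_delivered hd, arrival_succ, add_comm (x (n + 1)),
        add_sub_add_right_eq_sub]
      convert ih using 2
      ext u
      refine exists_congr fun j => and_congr_right fun hj => and_congr_left fun _ => ?_
      have : j ≠ n := fun h => hd (h ▸ hj)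
      omega

/-- If exactly the successful packets with index below `m` have been received by time `t`, then
the newest generation time is read off from the age at the arrival of packet `m`. -/
lemma newest_eq (hx : ∀ n, 0 < x n) (ha : 0 ≤ a₀) {m : ℕ} {t : ℝ}
    (h : ∀ j, Delivered x s j → (reception x s j ≤ t ↔ j < m)) :
    newest x s a₀ t = arrival x m - arrivalAge x s a₀ m := by
  rw [newest, ← (isGreatest_generation (s := s) hx ha m).csSup_eq]
  congr 2
  ext u
  constructor
  · rintro ⟨j, h1, h2, rfl⟩
    exact ⟨j, h1, (h j h1).1 h2, rfl⟩
  · rintro ⟨j, h1, h2, rfl⟩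
    exact ⟨j, h1, (h j h1).2 h2, rfl⟩

lemma bddAbove_generation (hs : ∀ n, 0 < s n) (t : ℝ) :
    BddAbove (insert (-a₀)
      {u | ∃ n, Delivered x s n ∧ reception x s n ≤ t ∧ u = arrival x n}) := by
  refine (bddAbove_insert (a := -a₀)).2 ⟨t, ?_⟩
  rintro u ⟨n, -, hn, rfl⟩
  exact (arrival_lt_reception hs n).le.trans hn

/-- Monotonicity gives integrability of the age on bounded intervals without locating the jumps. -/
lemma monotone_newest (hs : ∀ n, 0 < s n) : Monotone (newest x s a₀) := by
  intro t t' htt'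
  refine csSup_le_csSup (bddAbove_generation hs t') (Set.insert_nonempty _ _) ?_
  refine Set.insert_subset_insert ?_
  rintro u ⟨n, h1, h2, rfl⟩
  exact ⟨n, h1, h2.trans htt', rfl⟩

lemma intervalIntegrable_age (hs : ∀ n, 0 < s n) (a b : ℝ) :
    IntervalIntegrable (age x s a₀) volume a b :=
  intervalIntegral.intervalIntegrable_id.sub (monotone_newest hs).intervalIntegrable

lemma age_nonneg (hs : ∀ n, 0 < s n) (ha : 0 ≤ a₀) {t : ℝ} (ht : 0 ≤ t) : 0 ≤ age x s a₀ t := by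
  rw [age, sub_nonneg]
  refine csSup_le (Set.insert_nonempty _ _) ?_
  rintro u (rfl | ⟨n, -, hn, rfl⟩)
  · linarith
  · exact (arrival_lt_reception hs n).le.trans hn

lemma integral_age_of_newest_eq {a b c : ℝ} (hab : a ≤ b)
    (h : ∀ t, a ≤ t → t < b → newest x s a₀ t = c) :
    ∫ t in a..b, age x s a₀ t = (b ^ 2 - a ^ 2) / 2 - c * (b - a) := by
  have e : ∫ t in a..b, age x s a₀ t = ∫ t in a..b, (t - c) := by
    refine intervalIntegral.integral_congr_ae ?_
    -- The endpoint `b`, where a reception may change the value, is a null set.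
    filter_upwards [compl_mem_ae_iff.2 (measure_singleton (μ := (volume : Measure ℝ)) b)]
      with t ht htm
    rw [Set.uIoc_of_le hab] at htm
    rw [age, h t htm.1.le (lt_of_le_of_ne htm.2 ht)]
  rw [e, intervalIntegral.integral_sub intervalIntegral.intervalIntegrable_id
    intervalIntegrable_const, integral_id, intervalIntegral.integral_const,
    smul_eq_mul]
  ring

/-- The area under the age curve between two arrivals. -/
lemma integral_age_arrival (hx : ∀ n, 0 < x n) (hs : ∀ n, 0 < s n) (ha : 0 ≤ a₀) (n : ℕ) :
    ∫ t in (arrival x n)..(arrival x (n + 1)), age x s a₀ t =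
      arrivalAge x s a₀ n * min (s n) (x (n + 1)) + x (n + 1) ^ 2 / 2 := by
  have hbelow : ∀ j, Delivered x s j → j < n → ∀ t, arrival x n ≤ t → reception x s j ≤ t :=
    fun j hj hjn t ht => (reception_lt_arrival hx hj hjn).le.trans ht
  have habove : ∀ j, n < j → ∀ t, t < arrival x (n + 1) → t < reception x s j :=
    fun j hj t ht => ht.trans_le (((arrival_strictMono hx).monotone hj).trans
      (arrival_lt_reception hs j).le)
  by_cases hd : Delivered x s n
  · have hd' := delivered_iff.1 hd
    rw [← intervalIntegral.integral_add_adjacent_intervals (b := reception x s n)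
      (intervalIntegrable_age hs _ _) (intervalIntegrable_age hs _ _),
      integral_age_of_newest_eq (arrival_lt_reception hs n).le
        (c := arrival x n - arrivalAge x s a₀ n),
      integral_age_of_newest_eq hd.le (c := arrival x n), min_eq_left hd'.le, reception,
      arrival_succ]
    · ring
    · intro t h1 h2
      rw [newest_eq hx ha (m := n + 1), arrivalAge_of_delivered hd, arrival_succ,
        add_sub_cancel_right]
      intro j hj
      rcases lt_trichotomy j n with h | rfl | h
      · exact iff_of_true (hbelow j hj h t ((arrival_lt_reception hs n).le.trans h1)) (by omega)
      · exact iff_of_true h1 (by omega)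
      · exact iff_of_false (habove j h t h2).not_ge (by omega)
    · intro t h1 h2
      refine newest_eq hx ha fun j hj => ?_
      rcases lt_trichotomy j n with h | rfl | h
      · exact iff_of_true (hbelow j hj h t h1) h
      · exact iff_of_false h2.not_ge (by omega)
      · exact iff_of_false (habove j h t (h2.trans hd)).not_ge (by omega)
  · have hd' := mt delivered_iff.2 hd
    rw [integral_age_of_newest_eq ((arrival_strictMono hx).monotone n.le_succ)
      (c := arrival x n - arrivalAge x s a₀ n), min_eq_right (not_lt.1 hd'), arrival_succ]
    · ring
    · intro t h1 h2
      refine newest_eq hx ha fun j hj => ?_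
      rcases lt_trichotomy j n with h | rfl | h
      · exact iff_of_true (hbelow j hj h t h1) h
      · exact absurd hj hd
      · exact iff_of_false (habove j h t h2).not_ge (by omega)

lemma integral_age_zero_arrival (hx : ∀ n, 0 < x n) (hs : ∀ n, 0 < s n) (ha : 0 ≤ a₀) (n : ℕ) :
    ∫ t in (0 : ℝ)..(arrival x n), age x s a₀ t =
      (∫ t in (0 : ℝ)..(arrival x 0), age x s a₀ t) + ∑ j ∈ Finset.range n,
        (arrivalAge x s a₀ j * min (s j) (x (j + 1)) + x (j + 1) ^ 2 / 2) := by
  rw [← intervalIntegral.integral_add_adjacent_intervals (b := arrival x 0)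
      (intervalIntegrable_age hs _ _) (intervalIntegrable_age hs _ _),
    ← intervalIntegral.sum_integral_adjacent_intervals
      fun j _ => intervalIntegrable_age hs _ _]
  simp only [integral_age_arrival hx hs ha]

/-- The area under the age curve between two receptions. -/
lemma ageArea_eq (hx : ∀ n, 0 < x n) (hs : ∀ n, 0 < s n) (ha : 0 ≤ a₀)
    (hinf : {n | Delivered x s n}.Infinite) (i : ℕ) :
    ageArea x s a₀ i = systemTime x s i * interdeparture x s i + interdeparture x s i ^ 2 / 2 := by
  have hi := delivered_successIndex hinf i
  have hi' := delivered_successIndex hinf (i + 1)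
  have hlt := successIndex_strictMono hinf i.lt_succ_self
  -- The region is a trapezoid: the age rises with slope one from `T` to `T + Y`.
  rw [ageArea, integral_age_of_newest_eq (c := arrival x (successIndex x s i)), systemTime,
    interdeparture]
  · ring
  · exact ((reception_lt_arrival hx hi hlt).trans (arrival_lt_reception hs _)).le
  · intro t h1 h2
    rw [newest_eq hx ha (m := successIndex x s i + 1), arrivalAge_of_delivered hi, arrival_succ,
      add_sub_cancel_right]
    intro j hj
    rcases lt_trichotomy j (successIndex x s i) with h | rfl | h
    · refine iff_of_true (le_trans ?_ h1) (by omega)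
      exact ((reception_lt_arrival hx hj h).trans (arrival_lt_reception hs _)).le
    · exact iff_of_true h1 (by omega)
    · refine iff_of_false (not_le.2 (h2.trans_le ?_)) (by omega)
      rcases lt_trichotomy j (successIndex x s (i + 1)) with h' | rfl | h'
      · exact absurd hj (not_delivered_of_between hinf h h')
      · exact le_rfl
      · exact ((reception_lt_arrival hx hi' h').trans (arrival_lt_reception hs _)).le

end paths

/-! ### Deterministic passage from averages over indices to averages over time -/

lemma tendsto_succ_div {c : ℕ → ℝ} {ℓ : ℝ} (hc : Tendsto (fun n : ℕ => c n / n) atTop (𝓝 ℓ)) :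
    Tendsto (fun n : ℕ => c (n + 1) / n) atTop (𝓝 ℓ) := by
  have h1 : Tendsto (fun n : ℕ => 1 + 1 / (n : ℝ)) atTop (𝓝 1) := by
    simpa using (tendsto_one_div_atTop_nhds_zero_nat (𝕜 := ℝ)).const_add 1
  have h2 := (hc.comp (tendsto_add_atTop_nat 1)).mul h1
  rw [mul_one] at h2
  refine h2.congr' ?_
  filter_upwards [eventually_ne_atTop 0] with n hn
  have : (n : ℝ) ≠ 0 := by exact_mod_cast hn
  simp only [Function.comp_apply, Nat.cast_add, Nat.cast_one]
  field_simp

lemma tendsto_atTop_of_div {a : ℕ → ℝ} {ρ : ℝ} (hρ : 0 < ρ)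
    (ha : Tendsto (fun n : ℕ => a n / n) atTop (𝓝 ρ)) : Tendsto a atTop atTop := by
  refine (ha.pos_mul_atTop hρ (tendsto_natCast_atTop_atTop (R := ℝ))).congr' ?_
  filter_upwards [eventually_ne_atTop 0] with n hn
  have : (n : ℝ) ≠ 0 := by exact_mod_cast hn
  field_simp

/-- A renewal-reward principle for a deterministic path. -/
lemma tendsto_div_of_between {a c d : ℕ → ℝ} {f : ℝ → ℝ} {ρ ℓ : ℝ} (hmono : Monotone a)
    (hρ : 0 < ρ) (ha : Tendsto (fun n : ℕ => a n / n) atTop (𝓝 ρ))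
    (hc : Tendsto (fun n : ℕ => c n / n) atTop (𝓝 ℓ))
    (hd : Tendsto (fun n : ℕ => d n / n) atTop (𝓝 ℓ))
    (h : ∀ n t, a n ≤ t → t < a (n + 1) → c n ≤ f t ∧ f t ≤ d n) :
    Tendsto (fun t => f t / t) atTop (𝓝 (ℓ / ρ)) := by
  have hatop := tendsto_atTop_of_div hρ ha
  -- The condition `a 0 ≤ t` stands inside the existential so that `choose` gives an index for every
  -- real `t`.
  have hex : ∀ t, ∃ n, a 0 ≤ t → a n ≤ t ∧ t < a (n + 1) := by
    intro t
    classical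
    have hne : ∃ n, t < a n := (hatop.eventually_gt_atTop t).exists
    refine ⟨Nat.find hne - 1, fun h0 => ?_⟩
    have hpos : Nat.find hne ≠ 0 := fun h' => by
      have := Nat.find_spec hne
      rw [h'] at this
      linarith
    refine ⟨not_lt.1 (Nat.find_min hne (by omega)), ?_⟩
    rw [show Nat.find hne - 1 + 1 = Nat.find hne by omega]
    exact Nat.find_spec hne
  choose N hN using hex
  have hNtop : Tendsto N atTop atTop := by
    refine tendsto_atTop.2 fun b => ?_
    filter_upwards [eventually_ge_atTop (a 0), eventually_ge_atTop (a b)] with t h0 hb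
    by_contra hlt
    have := hmono (show N t + 1 ≤ b by omega)
    linarith [(hN t h0).2]
  have ha' := tendsto_succ_div ha
  have ht : Tendsto (fun t => t / (N t : ℝ)) atTop (𝓝 ρ) := by
    refine tendsto_of_tendsto_of_tendsto_of_le_of_le' (ha.comp hNtop) (ha'.comp hNtop) ?_ ?_
    · filter_upwards [eventually_ge_atTop (a 0)] with t h0
      exact div_le_div_of_nonneg_right (hN t h0).1 (Nat.cast_nonneg _)
    · filter_upwards [eventually_ge_atTop (a 0)] with t h0
      exact div_le_div_of_nonneg_right (hN t h0).2.le (Nat.cast_nonneg _)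
  have hf : Tendsto (fun t => f t / (N t : ℝ)) atTop (𝓝 ℓ) := by
    refine tendsto_of_tendsto_of_tendsto_of_le_of_le' (hc.comp hNtop) (hd.comp hNtop) ?_ ?_
    · filter_upwards [eventually_ge_atTop (a 0)] with t h0
      exact div_le_div_of_nonneg_right (h _ t (hN t h0).1 (hN t h0).2).1 (Nat.cast_nonneg _)
    · filter_upwards [eventually_ge_atTop (a 0)] with t h0
      exact div_le_div_of_nonneg_right (h _ t (hN t h0).1 (hN t h0).2).2 (Nat.cast_nonneg _)
  refine (hf.div ht hρ.ne').congr' ?_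
  filter_upwards [hNtop.eventually_ne_atTop 0] with t hNt
  have : (N t : ℝ) ≠ 0 := by exact_mod_cast hNt
  simp only [Pi.div_apply]
  field_simp

/-! ### A strong law of large numbers for orthogonal random variables -/

section orthogonal

variable {Ω : Type*} [MeasurableSpace Ω] {μ : Measure Ω}

/-- The sum of the functions has finite integral, so it is almost surely finite and its terms tend
to zero. -/
lemma ae_tendsto_zero_of_summable_integral {f : ℕ → Ω → ℝ} (hf : ∀ n, Integrable (f n) μ)
    (hnn : ∀ n ω, 0 ≤ f n ω) {u : ℕ → ℝ} (hu : Summable u) (h : ∀ n, ∫ ω, f n ω ∂μ ≤ u n) :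
    ∀ᵐ ω ∂μ, Tendsto (fun n => f n ω) atTop (𝓝 0) := by
  have hu0 : ∀ n, 0 ≤ u n := fun n => (integral_nonneg (hnn n)).trans (h n)
  have hm : ∀ n, AEMeasurable (fun ω => ENNReal.ofReal (f n ω)) μ := fun n =>
    (hf n).1.aemeasurable.ennreal_ofReal
  have hsum : ∫⁻ ω, ∑' n, ENNReal.ofReal (f n ω) ∂μ ≠ ∞ := by
    rw [lintegral_tsum hm]
    refine ne_top_of_le_ne_top (hu.tsum_ofReal_ne_top) (ENNReal.tsum_le_tsum fun n => ?_)
    rw [← ofReal_integral_eq_lintegral_ofReal (hf n) (ae_of_all _ (hnn n))]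
    exact ENNReal.ofReal_le_ofReal (h n)
  filter_upwards [ae_lt_top' (AEMeasurable.tsum hm) hsum] with ω hω
  have h0 := ENNReal.tendsto_atTop_zero_of_tsum_ne_top hω.ne
  have h1 := (ENNReal.tendsto_toReal ENNReal.zero_ne_top).comp h0
  simpa [Function.comp_def, ENNReal.toReal_ofReal (hnn _ _)] using h1

variable {ξ : ℕ → Ω → ℝ} {C : ℝ} (hmem : ∀ n, MemLp (ξ n) 2 μ)
  (horth : ∀ i j, i < j → ∫ ω, ξ i ω * ξ j ω ∂μ = 0) (hC : ∀ n, ∫ ω, ξ n ω ^ 2 ∂μ ≤ C)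
include hmem horth hC

/-- Orthogonality kills the cross terms, leaving at most `C` for each index. -/
lemma integral_sum_sq_le (t : Finset ℕ) :
    Integrable (fun ω => (∑ j ∈ t, ξ j ω) ^ 2) μ ∧
      ∫ ω, (∑ j ∈ t, ξ j ω) ^ 2 ∂μ ≤ C * t.card := by
  have hprod : ∀ i j, Integrable (fun ω => ξ i ω * ξ j ω) μ := fun i j =>
    (hmem i).integrable_mul (hmem j)
  have hne : ∀ i j, i ≠ j → ∫ ω, ξ i ω * ξ j ω ∂μ = 0 := by
    intro i j hij
    rcases hij.lt_or_gt with h | h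
    · exact horth i j h
    · simp_rw [mul_comm (ξ i _)]
      exact horth j i h
  have e : ∀ ω, (∑ j ∈ t, ξ j ω) ^ 2 = ∑ i ∈ t, ∑ j ∈ t, ξ i ω * ξ j ω := fun ω => by
    rw [sq, Finset.sum_mul_sum]
  simp only [e]
  refine ⟨integrable_finsetSum _ fun i _ => integrable_finsetSum _ fun j _ => hprod i j, ?_⟩
  rw [integral_finsetSum _ fun i _ => integrable_finsetSum _ fun j _ => hprod i j]
  have hle : ∀ i ∈ t, ∫ ω, ∑ j ∈ t, ξ i ω * ξ j ω ∂μ ≤ C := by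
    intro i hi
    rw [integral_finsetSum _ fun j _ => hprod i j,
      Finset.sum_eq_single_of_mem i hi fun j _ hj => hne i j hj.symm]
    simpa only [sq] using hC i
  calc _ ≤ ∑ _i ∈ t, C := Finset.sum_le_sum hle
    _ = C * t.card := by rw [Finset.sum_const, nsmul_eq_mul, mul_comm]

/-- Strong law of large numbers for orthogonal random variables with bounded second moments. -/
theorem ae_tendsto_average_of_orthogonal :
    ∀ᵐ ω ∂μ, Tendsto (fun n : ℕ => (∑ j ∈ Finset.range n, ξ j ω) / n) atTop (𝓝 0) := by
  have hC0 : 0 ≤ C := (integral_nonneg fun ω => sq_nonneg (ξ 0 ω)).trans (hC 0)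
  -- The `9` comes from the blocks below: at most `3 * j` partial sums, each with second moment at
  -- most `C * (3 * j)`, divided by `j ^ 4`.
  have hsum : Summable fun j : ℕ => 9 * C * (1 / (j : ℝ) ^ 2) :=
    (Real.summable_one_div_nat_pow.2 one_lt_two).mul_left _
  have hA := ae_tendsto_zero_of_summable_integral (μ := μ)
    (f := fun j ω => (∑ i ∈ Finset.range (j ^ 2), ξ i ω) ^ 2 / ((j : ℝ) ^ 2) ^ 2)
    (fun j => (integral_sum_sq_le hmem horth hC _).1.div_const _) (fun j ω => by positivity) hsum
    (fun j => by
      have h := (integral_sum_sq_le hmem horth hC (Finset.range (j ^ 2))).2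
      rw [integral_div]
      rcases Nat.eq_zero_or_pos j with rfl | hj
      · simp
      · have hj' : (0 : ℝ) < j := by exact_mod_cast hj
        rw [div_le_iff₀ (by positivity)]
        refine h.trans ?_
        rw [Finset.card_range]
        push_cast
        have : 9 * C * (1 / (j : ℝ) ^ 2) * ((j : ℝ) ^ 2) ^ 2 = 9 * (C * (j : ℝ) ^ 2) := by
          field_simp
        rw [this]
        nlinarith [mul_nonneg hC0 (sq_nonneg (j : ℝ))])
  -- Between consecutive squares, the sum of all squared partial sums replaces a maximal inequality;
  -- since `(j + 1) ^ 2 = j ^ 2 + 2 * j + 1`, the offsets are `0, …, 2 * j`.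
  have hB := ae_tendsto_zero_of_summable_integral (μ := μ)
    (f := fun j ω => (∑ d ∈ Finset.range (2 * j + 1),
      (∑ i ∈ Finset.Ico (j ^ 2) (j ^ 2 + d), ξ i ω) ^ 2) / ((j : ℝ) ^ 2) ^ 2)
    (fun j => (integrable_finsetSum _ fun d _ =>
      (integral_sum_sq_le hmem horth hC _).1).div_const _) (fun j ω => by positivity) hsum
    (fun j => by
      rw [integral_div, integral_finsetSum _ fun d _ => (integral_sum_sq_le hmem horth hC _).1]
      rcases Nat.eq_zero_or_pos j with rfl | hj
      · simp
      · have hj' : (1 : ℝ) ≤ j := by exact_mod_cast hj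
        rw [div_le_iff₀ (by positivity)]
        have hle : ∀ d ∈ Finset.range (2 * j + 1),
            ∫ ω, (∑ i ∈ Finset.Ico (j ^ 2) (j ^ 2 + d), ξ i ω) ^ 2 ∂μ ≤ C * (3 * j) := by
          intro d hd
          refine (integral_sum_sq_le hmem horth hC _).2.trans ?_
          rw [Nat.card_Ico, Nat.add_sub_cancel_left]
          refine mul_le_mul_of_nonneg_left ?_ hC0
          have : d ≤ 2 * j := Nat.lt_succ_iff.1 (Finset.mem_range.1 hd)
          have : (d : ℝ) ≤ 2 * j := by exact_mod_cast this
          linarith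
        refine (Finset.sum_le_sum hle).trans ?_
        rw [Finset.sum_const, Finset.card_range, nsmul_eq_mul]
        push_cast
        have : 9 * C * (1 / (j : ℝ) ^ 2) * ((j : ℝ) ^ 2) ^ 2 = (3 * j) * (C * (3 * j)) := by
          field_simp
          ring
        rw [this]
        exact mul_le_mul_of_nonneg_right (by linarith) (by positivity))
  filter_upwards [hA, hB] with ω hA hB
  have hsqrt : Tendsto Nat.sqrt atTop atTop :=
    tendsto_atTop.2 fun b => by
      filter_upwards [eventually_ge_atTop (b * b)] with n hn
      exact Nat.le_sqrt.2 hn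
  have hlim := ((hA.const_mul 2).add (hB.const_mul 2)).comp hsqrt
  rw [mul_zero, add_zero] at hlim
  have hsq : Tendsto (fun n : ℕ => ((∑ j ∈ Finset.range n, ξ j ω) / n) ^ 2) atTop (𝓝 0) := by
    refine squeeze_zero' (Eventually.of_forall fun n => sq_nonneg _) ?_ hlim
    filter_upwards [eventually_ge_atTop 1] with n hn
    set j := Nat.sqrt n with hj
    have hj1 : 1 ≤ j := Nat.le_sqrt.2 (by simpa using hn)
    have hjn : j ^ 2 ≤ n := Nat.sqrt_le' n
    have hnj : n ≤ j * j + j + j := Nat.sqrt_le_add n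
    have hd : n - j ^ 2 ∈ Finset.range (2 * j + 1) := by
      rw [Finset.mem_range, sq]
      omega
    have hsplit : ∑ i ∈ Finset.range n, ξ i ω = ∑ i ∈ Finset.range (j ^ 2), ξ i ω +
        ∑ i ∈ Finset.Ico (j ^ 2) (j ^ 2 + (n - j ^ 2)), ξ i ω := by
      rw [Nat.add_sub_cancel' hjn, Finset.sum_range_add_sum_Ico _ hjn]
    have hone := Finset.single_le_sum
      (f := fun d => (∑ i ∈ Finset.Ico (j ^ 2) (j ^ 2 + d), ξ i ω) ^ 2)
      (fun d _ => sq_nonneg _) hd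
    simp only [Function.comp_apply, ← hj]
    rw [← mul_div_assoc, ← mul_div_assoc, ← add_div, div_pow, hsplit]
    have hjpos : (0 : ℝ) < (j : ℝ) ^ 2 := by
      have : (0 : ℝ) < j := by exact_mod_cast hj1
      positivity
    have hjn' : (j : ℝ) ^ 2 ≤ n := by exact_mod_cast hjn
    refine div_le_div₀ (by positivity) ?_ (by positivity) (by gcongr)
    refine (add_sq_le).trans ?_
    rw [mul_add]
    gcongr
  have habs := hsq.sqrt
  simp only [Real.sqrt_sq_eq_abs, Real.sqrt_zero] at habs
  exact (tendsto_zero_iff_abs_tendsto_zero _).2 habs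

end orthogonal

/-! ### Averages of the age at arrival times -/

section pair

variable {lam k θ : ℝ} (hlam : 0 < lam) (hk : 0 < k) (hθ : 0 < θ)
include hlam hk hθ

lemma ae_pos_pairLaw : ∀ᵐ q ∂pairLaw lam k θ, 0 < q.1 ∧ 0 < q.2 := by
  have := isProbabilityMeasure_gammaMeasure hk (one_div_pos.2 hθ)
  have := isProbabilityMeasure_expMeasure hlam
  have h1 : ∀ᵐ q ∂pairLaw lam k θ, 0 < q.1 :=
    Measure.quasiMeasurePreserving_fst.ae (ae_pos_gammaMeasure k (1 / θ))
  have h2 : ∀ᵐ q ∂pairLaw lam k θ, 0 < q.2 :=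
    Measure.quasiMeasurePreserving_snd.ae (ae_pos_gammaMeasure 1 lam)
  exact h1.and h2

lemma integral_pairLaw_snd :
    Integrable (fun q : ℝ × ℝ => q.2) (pairLaw lam k θ) ∧
      ∫ q, q.2 ∂pairLaw lam k θ = 1 / lam := by
  have h := lintegral_pairLaw_snd hlam hk hθ (f := fun x => ENNReal.ofReal x) (by fun_prop)
  rw [expMeasure, lintegral_id_gammaMeasure one_pos hlam] at h
  have hnn : 0 ≤ᵐ[pairLaw lam k θ] fun q : ℝ × ℝ => q.2 := by
    filter_upwards [ae_pos_pairLaw hlam hk hθ] with q hq using hq.2.le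
  have hm : AEStronglyMeasurable (fun q : ℝ × ℝ => q.2) (pairLaw lam k θ) :=
    measurable_snd.aestronglyMeasurable
  constructor
  · rw [← lintegral_ofReal_ne_top_iff_integrable hm hnn, h]
    exact ENNReal.ofReal_ne_top
  · rw [integral_eq_lintegral_of_nonneg_ae hnn hm, h, ENNReal.toReal_ofReal (by positivity)]

lemma integral_pairLaw_snd_sq :
    Integrable (fun q : ℝ × ℝ => q.2 ^ 2) (pairLaw lam k θ) ∧
      ∫ q, q.2 ^ 2 ∂pairLaw lam k θ = 2 / lam ^ 2 := by
  have h := lintegral_pairLaw_snd hlam hk hθ (f := fun x => ENNReal.ofReal (x ^ 2)) (by fun_prop)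
  rw [expMeasure, lintegral_sq_gammaMeasure one_pos hlam] at h
  have hnn : 0 ≤ᵐ[pairLaw lam k θ] fun q : ℝ × ℝ => q.2 ^ 2 := ae_of_all _ fun q => sq_nonneg _
  have hm : AEStronglyMeasurable (fun q : ℝ × ℝ => q.2 ^ 2) (pairLaw lam k θ) :=
    (measurable_snd.pow_const 2).aestronglyMeasurable
  constructor
  · rw [← lintegral_ofReal_ne_top_iff_integrable hm hnn, h]
    exact ENNReal.ofReal_ne_top
  · rw [integral_eq_lintegral_of_nonneg_ae hnn hm, h, ENNReal.toReal_ofReal (by positivity)]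
    norm_num

lemma memLp_pairLaw_snd : MemLp (fun q : ℝ × ℝ => q.2) 2 (pairLaw lam k θ) :=
  (memLp_two_iff_integrable_sq measurable_snd.aestronglyMeasurable).2
    (integral_pairLaw_snd_sq hlam hk hθ).1

lemma memLp_pairLaw_min : MemLp (fun q : ℝ × ℝ => min q.1 q.2) 2 (pairLaw lam k θ) := by
  refine (memLp_pairLaw_snd hlam hk hθ).mono
    (measurable_fst.min measurable_snd).aestronglyMeasurable ?_
  filter_upwards [ae_pos_pairLaw hlam hk hθ] with q hq
  rw [Real.norm_of_nonneg (le_min hq.1.le hq.2.le), Real.norm_of_nonneg hq.2.le]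
  exact min_le_right _ _

/-- The minimum is the interarrival time minus its excess over the service time on success. -/
lemma integral_pairLaw_min :
    ∫ q, min q.1 q.2 ∂pairLaw lam k θ = (1 - (1 + lam * θ) ^ (-k)) / lam := by
  have h := lintegral_pairLaw_excess hlam hk hθ
  have hnn : 0 ≤ᵐ[pairLaw lam k θ] fun q : ℝ × ℝ => if q.1 < q.2 then q.2 - q.1 else 0 :=
    ae_of_all _ fun q => by
      dsimp only [Pi.zero_apply]
      split_ifs with hq
      · linarith
      · exact le_rfl
  have hm : Measurable (fun q : ℝ × ℝ => if q.1 < q.2 then q.2 - q.1 else 0) :=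
    Measurable.ite measurableSet_lt_pair (by fun_prop) measurable_const
  have he : ∫ q, (if q.1 < q.2 then q.2 - q.1 else 0) ∂pairLaw lam k θ =
      (1 + lam * θ) ^ (-k) / lam := by
    rw [integral_eq_lintegral_of_nonneg_ae hnn hm.aestronglyMeasurable,
      ← ENNReal.toReal_ofReal (show 0 ≤ (1 + lam * θ) ^ (-k) / lam by positivity), ← h]
    congr 1
    refine lintegral_congr fun q => ?_
    split_ifs <;> simp
  have hprob := isProbabilityMeasure_pairLaw hlam hk hθ
  have hint1 := (integral_pairLaw_snd hlam hk hθ).1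
  have hint2 := (memLp_pairLaw_min hlam hk hθ).integrable one_le_two
  have e : ∀ q : ℝ × ℝ, (if q.1 < q.2 then q.2 - q.1 else 0) = q.2 - min q.1 q.2 := by
    intro q
    split_ifs with hq
    · rw [min_eq_left hq.le]
    · rw [min_eq_right (not_lt.1 hq), sub_self]
  simp only [e] at he
  rw [integral_sub hint1 hint2, (integral_pairLaw_snd hlam hk hθ).2] at he
  rw [sub_div]
  linarith

end pair

/-- The indicator of an unsuccessful packet. -/
noncomputable def failure (q : ℝ × ℝ) : ℝ := if q.1 < q.2 then 0 else 1

lemma measurable_failure : Measurable failure :=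
  Measurable.ite measurableSet_lt_pair measurable_const measurable_const

lemma failure_mem_Icc (q : ℝ × ℝ) : 0 ≤ failure q ∧ failure q ≤ 1 := by
  unfold failure; split_ifs <;> simp

lemma memLp_failure {lam k θ : ℝ} (hlam : 0 < lam) (hk : 0 < k) (hθ : 0 < θ) :
    MemLp failure 2 (pairLaw lam k θ) := by
  have := isProbabilityMeasure_pairLaw hlam hk hθ
  refine MemLp.of_bound measurable_failure.aestronglyMeasurable 1 (ae_of_all _ fun q => ?_)
  rw [Real.norm_of_nonneg (failure_mem_Icc q).1]
  exact (failure_mem_Icc q).2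

lemma integral_failure {lam k θ : ℝ} (hlam : 0 < lam) (hk : 0 < k) (hθ : 0 < θ) :
    ∫ q, failure q ∂pairLaw lam k θ = 1 - (1 + lam * θ) ^ (-k) := by
  have := isProbabilityMeasure_pairLaw hlam hk hθ
  have e : failure = fun q => 1 - {q : ℝ × ℝ | q.1 < q.2}.indicator (1 : ℝ × ℝ → ℝ) q := by
    ext q
    by_cases h : q.1 < q.2 <;> simp [failure, h]
  have hi : Integrable ({q : ℝ × ℝ | q.1 < q.2}.indicator (1 : ℝ × ℝ → ℝ)) (pairLaw lam k θ) :=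
    (integrable_const (1 : ℝ)).indicator measurableSet_lt_pair
  rw [e]
  beta_reduce
  rw [integral_sub (integrable_const _) hi, integral_indicator_one measurableSet_lt_pair,
    Measure.real, pairLaw_lt hlam hk hθ, ENNReal.toReal_ofReal (by positivity)]
  simp

/-! ### The recursion for the ages at arrivals, started from initial age zero -/

section history

variable {Ω : Type*} {X S : ℕ → Ω → ℝ}

lemma arrivalAge_succ_eq (n : ℕ) (ω : Ω) :
    arrivalAge (path X ω) (path S ω) 0 (n + 1) =
      (pair X S n ω).2 + failure (pair X S n ω) * arrivalAge (path X ω) (path S ω) 0 n := by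
  by_cases h : S n ω < X (n + 1) ω <;> simp [arrivalAge, failure, pair, path, h]

lemma measurable_arrivalAge_history (n : ℕ) :
    Measurable[history X S n] fun ω => arrivalAge (path X ω) (path S ω) 0 n := by
  induction n with
  | zero =>
    simp only [arrivalAge, add_zero]
    exact measurable_history (j := Sum.inl 0) (show (0 : ℕ) ≤ 0 from le_rfl)
  | succ n ih =>
    simp only [arrivalAge_succ_eq]
    have hp : Measurable[history X S (n + 1)] (pair X S n) :=
      measurable_pair_history n.lt_succ_self
    exact (measurable_snd.comp hp).add
      ((measurable_failure.comp hp).mul (ih.mono (history_mono n.le_succ) le_rfl))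

end history

namespace PoissonGammaInput

variable {Ω : Type*} [MeasurableSpace Ω] {μ : Measure Ω} [IsProbabilityMeasure μ]
  {lam k θ : ℝ} {X S : ℕ → Ω → ℝ}
  (hXS : PoissonGammaInput μ lam k θ X S)
include hXS

lemma integral_history_mul {n : ℕ} {F : Ω → ℝ} (hF : Measurable[history X S n] F)
    (hFint : Integrable F μ) {φ : ℝ × ℝ → ℝ} (hφ : Measurable φ)
    (hφint : Integrable φ (pairLaw lam k θ)) :
    Integrable (fun ω => F ω * φ (pair X S n ω)) μ ∧
      ∫ ω, F ω * φ (pair X S n ω) ∂μ = (∫ ω, F ω ∂μ) * ∫ q, φ q ∂pairLaw lam k θ := by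
  have hind := hXS.indepFun_comp_pair hF hφ
  have hm := hφ.comp (hXS.measurable_pair n)
  rw [← hXS.map_pair n] at hφint
  have hint := hφint.comp_measurable (hXS.measurable_pair n)
  refine ⟨hind.integrable_mul hFint hint, ?_⟩
  rw [hind.integral_fun_mul_eq_mul_integral hFint.1 hint.1, ← hXS.map_pair n,
    integral_map (hXS.measurable_pair n).aemeasurable hφ.aestronglyMeasurable]

lemma memLp_pair {φ : ℝ × ℝ → ℝ} (hφint : MemLp φ 2 (pairLaw lam k θ)) (n : ℕ) :
    MemLp (fun ω => φ (pair X S n ω)) 2 μ := by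
  rw [← hXS.map_pair n] at hφint
  exact hφint.comp_of_map (hXS.measurable_pair n).aemeasurable

lemma integral_pair {φ : ℝ × ℝ → ℝ} (hφ : Measurable φ) (n : ℕ) :
    ∫ ω, φ (pair X S n ω) ∂μ = ∫ q, φ q ∂pairLaw lam k θ := by
  rw [← hXS.map_pair n,
    integral_map (hXS.measurable_pair n).aemeasurable hφ.aestronglyMeasurable]

variable (hlam : 0 < lam) (hk : 0 < k) (hθ : 0 < θ)
include hlam hk hθ

/-- The ages at the arrival times have bounded second moments. -/
lemma exists_bound_arrivalAge_sq :
    ∃ C : ℝ, ∀ n, MemLp (fun ω => arrivalAge (path X ω) (path S ω) 0 n) 2 μ ∧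
      ∫ ω, arrivalAge (path X ω) (path S ω) 0 n ^ 2 ∂μ ≤ C := by
  set p := (1 + lam * θ) ^ (-k) with hp
  have hp0 : 0 < p := by positivity
  have hp1 : p < 1 := rpow_neg_lt_one hk (by positivity)
  set V := 2 / lam ^ 2 with hV
  have hV0 : 0 < V := by positivity
  -- This is an upper barrier for `u ↦ (1 + 2 / p) * V + (1 + p / 2) * (1 - p) * u`, whose slope is
  -- below `1 - p / 2`.
  refine ⟨(1 + 2 / p) * V * (2 / p), fun n => ?_⟩
  induction n with
  | zero =>
    simp only [arrivalAge, add_zero]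
    -- `X 0` belongs to no pair, so its moments are transferred from `X 1`.
    have hlaw : μ.map (X 0) = μ.map (X 1) := by
      rw [hXS.law_interarrival, hXS.law_interarrival]
    have hid : IdentDistrib (X 1) (X 0) μ μ :=
      ⟨(hXS.measurable_interarrival 1).aemeasurable,
        (hXS.measurable_interarrival 0).aemeasurable, hlaw.symm⟩
    have h1 : MemLp (X 1) 2 μ := hXS.memLp_pair (memLp_pairLaw_snd hlam hk hθ) 0
    refine ⟨hid.memLp_snd h1, ?_⟩
    have h2 : ∫ ω, X 1 ω ^ 2 ∂μ = V := by
      rw [hV, ← (integral_pairLaw_snd_sq hlam hk hθ).2]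
      exact hXS.integral_pair (measurable_snd.pow_const 2) 0
    have h3 : ∫ ω, X 0 ω ^ 2 ∂μ = V := by
      rw [← h2]
      exact ((hid.comp (measurable_id.pow_const 2)).integral_eq).symm
    have h4 : ∫ ω, path X ω 0 ^ 2 ∂μ = V := h3
    rw [h4]
    have : 1 ≤ 2 / p := by rw [le_div_iff₀ hp0]; linarith
    have : 0 ≤ 2 / p := by positivity
    calc V = 1 * V * 1 := by ring
      _ ≤ (1 + 2 / p) * V * (2 / p) := by gcongr; linarith
  | succ n ih =>
    obtain ⟨ihL, ihC⟩ := ih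
    have hA := measurable_arrivalAge_history (X := X) (S := S) n
    have hx : MemLp (fun ω => (pair X S n ω).2) 2 μ :=
      hXS.memLp_pair (memLp_pairLaw_snd hlam hk hθ) n
    have hFA : MemLp (fun ω => failure (pair X S n ω) * arrivalAge (path X ω) (path S ω) 0 n)
        2 μ := by
      refine ihL.mono ((measurable_failure.comp (hXS.measurable_pair n)).mul
        (hA.mono (hXS.history_le n) le_rfl)).aestronglyMeasurable (ae_of_all _ fun ω => ?_)
      rw [norm_mul, Real.norm_of_nonneg (failure_mem_Icc _).1]
      exact mul_le_of_le_one_left (norm_nonneg _) (failure_mem_Icc _).2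
    have hmem : MemLp (fun ω => arrivalAge (path X ω) (path S ω) 0 (n + 1)) 2 μ := by
      simp only [arrivalAge_succ_eq]
      exact hx.add hFA
    refine ⟨hmem, ?_⟩
    have hprob := isProbabilityMeasure_pairLaw hlam hk hθ
    have hF := hXS.integral_history_mul (hA.pow_const 2) ihL.integrable_sq measurable_failure
      ((memLp_failure hlam hk hθ).integrable one_le_two)
    rw [integral_failure hlam hk hθ, ← hp] at hF
    have hpt : ∀ ω, arrivalAge (path X ω) (path S ω) 0 (n + 1) ^ 2 ≤
        (1 + 2 / p) * (pair X S n ω).2 ^ 2 + (1 + p / 2) *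
          (arrivalAge (path X ω) (path S ω) 0 n ^ 2 * failure (pair X S n ω)) := by
      intro ω
      rw [arrivalAge_succ_eq]
      set y := (pair X S n ω).2
      -- The weight in the next inequality makes the coefficient of `a ^ 2` exceed one by only `p /
      -- 2`, less than the mean loss `p` due to successes.
      set a := arrivalAge (path X ω) (path S ω) 0 n
      have key : 2 * y * a ≤ 2 / p * y ^ 2 + p / 2 * a ^ 2 := by
        have h := sq_nonneg (2 / p * y - a)
        have h' : p / 2 * (2 / p * y - a) ^ 2 = 2 / p * y ^ 2 - 2 * y * a + p / 2 * a ^ 2 := by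
          field_simp
          ring
        have := mul_nonneg (half_pos hp0).le h
        linarith
      unfold failure
      split_ifs
      · have : 0 ≤ 2 / p * y ^ 2 := by positivity
        linarith
      · linarith
    have hxV : ∫ ω, (pair X S n ω).2 ^ 2 ∂μ = V := by
      rw [hV, ← (integral_pairLaw_snd_sq hlam hk hθ).2]
      exact hXS.integral_pair (measurable_snd.pow_const 2) n
    calc ∫ ω, arrivalAge (path X ω) (path S ω) 0 (n + 1) ^ 2 ∂μ
        ≤ ∫ ω, ((1 + 2 / p) * (pair X S n ω).2 ^ 2 + (1 + p / 2) *
          (arrivalAge (path X ω) (path S ω) 0 n ^ 2 * failure (pair X S n ω))) ∂μ :=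
          integral_mono hmem.integrable_sq
            ((hx.integrable_sq.const_mul _).add (hF.1.const_mul _)) hpt
      _ = (1 + 2 / p) * V + (1 + p / 2) *
          ((∫ ω, arrivalAge (path X ω) (path S ω) 0 n ^ 2 ∂μ) * (1 - p)) := by
          rw [integral_add (hx.integrable_sq.const_mul _) (hF.1.const_mul _),
            integral_const_mul, integral_const_mul, hF.2, hxV]
      _ ≤ (1 + 2 / p) * V + (1 + p / 2) * (((1 + 2 / p) * V * (2 / p)) * (1 - p)) := by
          have : 0 ≤ 1 - p := by linarith
          gcongr
      _ ≤ (1 + 2 / p) * V * (2 / p) := by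
          set B := (1 + 2 / p) * V
          have hB : 0 < B := by positivity
          have e : B + (1 + p / 2) * (B * (2 / p) * (1 - p)) - B * (2 / p) = -(B * p) := by
            field_simp; ring
          nlinarith [mul_pos hB hp0]

/-- Weighted by the ages at the arrival times, a centred function of the next service and
interarrival times has vanishing averages. -/
lemma ae_tendsto_average_arrivalAge_mul {φ : ℝ × ℝ → ℝ} (hφ : Measurable φ)
    (hφL : MemLp φ 2 (pairLaw lam k θ)) :
    ∀ᵐ ω ∂μ, Tendsto (fun n : ℕ => (∑ j ∈ Finset.range n,
      arrivalAge (path X ω) (path S ω) 0 j *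
        (φ (pair X S j ω) - ∫ q, φ q ∂pairLaw lam k θ)) / n) atTop (𝓝 0) := by
  have hprob := isProbabilityMeasure_pairLaw hlam hk hθ
  obtain ⟨C, hC⟩ := hXS.exists_bound_arrivalAge_sq hlam hk hθ
  set ψ : ℝ × ℝ → ℝ := fun q => φ q - ∫ q, φ q ∂pairLaw lam k θ with hψ
  have hψm : Measurable ψ := hφ.sub_const _
  have hψL : MemLp ψ 2 (pairLaw lam k θ) := hφL.sub (memLp_const _)
  have hψint := hψL.integrable one_le_two
  have hψ0 : ∫ q, ψ q ∂pairLaw lam k θ = 0 := by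
    rw [hψ, integral_sub (hφL.integrable one_le_two) (integrable_const _)]
    simp
  have hA := measurable_arrivalAge_history (X := X) (S := S)
  have hξ : ∀ n, Measurable fun ω =>
      arrivalAge (path X ω) (path S ω) 0 n * ψ (pair X S n ω) := fun n =>
    ((hA n).mono (hXS.history_le n) le_rfl).mul (hψm.comp (hXS.measurable_pair n))
  have hsq := fun n => hXS.integral_history_mul ((hA n).pow_const 2) (hC n).1.integrable_sq
    (hψm.pow_const 2) hψL.integrable_sq
  have hmem : ∀ n, MemLp (fun ω =>
      arrivalAge (path X ω) (path S ω) 0 n * ψ (pair X S n ω)) 2 μ := by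
    intro n
    refine (memLp_two_iff_integrable_sq (hξ n).aestronglyMeasurable).2 ?_
    simp only [mul_pow]
    exact (hsq n).1
  refine ae_tendsto_average_of_orthogonal hmem ?_
    (C := C * ∫ q, ψ q ^ 2 ∂pairLaw lam k θ) ?_
  · intro i j hij
    -- For `i < j`, every factor of the product except the centred one at `j` is known at arrival
    -- `j`, so the expectation vanishes.
    have hF : Measurable[history X S j] fun ω =>
        arrivalAge (path X ω) (path S ω) 0 i * ψ (pair X S i ω) *
          arrivalAge (path X ω) (path S ω) 0 j :=
      (((hA i).mono (history_mono hij.le) le_rfl).mul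
        (hψm.comp (measurable_pair_history hij))).mul (hA j)
    have h := hXS.integral_history_mul hF ((hmem i).integrable_mul (hC j).1) hψm hψint
    rw [hψ0, mul_zero] at h
    simpa only [mul_assoc] using h.2
  · intro n
    simp only [mul_pow]
    rw [(hsq n).2]
    exact mul_le_mul_of_nonneg_right (hC n).2 (integral_nonneg fun q => sq_nonneg _)

/-- Bounded second moments make `E (A n) ^ 2 / n ^ 2` summable; the lemma disposes of the boundary
term when the recursion is summed. -/
lemma ae_tendsto_arrivalAge_div :
    ∀ᵐ ω ∂μ, Tendsto (fun n : ℕ => arrivalAge (path X ω) (path S ω) 0 n / n) atTop (𝓝 0) := by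
  obtain ⟨C, hC⟩ := hXS.exists_bound_arrivalAge_sq hlam hk hθ
  have h := ae_tendsto_zero_of_summable_integral (μ := μ)
    (f := fun n ω => arrivalAge (path X ω) (path S ω) 0 n ^ 2 / (n : ℝ) ^ 2)
    (fun n => (hC n).1.integrable_sq.div_const _) (fun n ω => by positivity)
    ((Real.summable_one_div_nat_pow.2 one_lt_two).mul_left C) (fun n => by
      rw [integral_div, mul_one_div]
      exact div_le_div_of_nonneg_right (hC n).2 (by positivity))
  filter_upwards [h] with ω hω
  have habs := hω.sqrt
  simp only [← div_pow, Real.sqrt_sq_eq_abs, Real.sqrt_zero] at habs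
  exact (tendsto_zero_iff_abs_tendsto_zero _).2 habs

lemma ae_tendsto_arrival_div :
    ∀ᵐ ω ∂μ, Tendsto (fun n : ℕ => arrival (path X ω) n / n) atTop (𝓝 (1 / lam)) := by
  have h := hXS.ae_tendsto_average_pair measurable_snd (integral_pairLaw_snd hlam hk hθ).1
  rw [(integral_pairLaw_snd hlam hk hθ).2] at h
  filter_upwards [h] with ω hω
  have h0 := (tendsto_const_div_atTop_nhds_zero_nat (X 0 ω)).add hω
  rw [zero_add] at h0
  refine h0.congr fun n => ?_
  rw [← add_div, arrival, Finset.sum_range_succ', add_comm]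
  rfl

/-- Sum the recursion over `j < n`. Replacing each failure indicator by its mean `1 - p` costs only
a vanishing average, and the shift of index leaves two negligible boundary terms; hence `p` times
the average age tends to `1 / lam`. -/
lemma ae_tendsto_average_arrivalAge :
    ∀ᵐ ω ∂μ, Tendsto (fun n : ℕ =>
      (∑ j ∈ Finset.range n, arrivalAge (path X ω) (path S ω) 0 j) / n) atTop
      (𝓝 ((1 + lam * θ) ^ k / lam)) := by
  have h1 := hXS.ae_tendsto_average_pair measurable_snd (integral_pairLaw_snd hlam hk hθ).1
  have h2 := hXS.ae_tendsto_average_arrivalAge_mul hlam hk hθ measurable_failure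
    (memLp_failure hlam hk hθ)
  have h3 := hXS.ae_tendsto_arrivalAge_div hlam hk hθ
  rw [(integral_pairLaw_snd hlam hk hθ).2] at h1
  rw [integral_failure hlam hk hθ] at h2
  have hp0 : 0 < (1 + lam * θ) ^ (-k) := by positivity
  have hpinv : (1 + lam * θ) ^ k = ((1 + lam * θ) ^ (-k))⁻¹ := by
    rw [Real.rpow_neg (by positivity), inv_inv]
  set p := (1 + lam * θ) ^ (-k)
  filter_upwards [h1, h2, h3] with ω h1 h2 h3
  have h0 := tendsto_const_div_atTop_nhds_zero_nat (arrivalAge (path X ω) (path S ω) 0 0)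
  have h := (((h1.add h2).sub h3).add h0).div_const p
  rw [add_zero, sub_zero, add_zero, div_div] at h
  rw [hpinv, show p⁻¹ / lam = 1 / (lam * p) by field_simp]
  refine h.congr fun n => ?_
  have hrec : ∑ j ∈ Finset.range n, arrivalAge (path X ω) (path S ω) 0 (j + 1) =
      ∑ j ∈ Finset.range n, (pair X S j ω).2 + ∑ j ∈ Finset.range n,
        failure (pair X S j ω) * arrivalAge (path X ω) (path S ω) 0 j := by
    rw [← Finset.sum_add_distrib]
    exact Finset.sum_congr rfl fun j _ => arrivalAge_succ_eq j ω
  have htel := Finset.sum_range_succ' (fun j => arrivalAge (path X ω) (path S ω) 0 j) n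
  rw [Finset.sum_range_succ, hrec] at htel
  have hexp : ∑ j ∈ Finset.range n, arrivalAge (path X ω) (path S ω) 0 j *
      (failure (pair X S j ω) - (1 - p)) = ∑ j ∈ Finset.range n,
        failure (pair X S j ω) * arrivalAge (path X ω) (path S ω) 0 j -
        (1 - p) * ∑ j ∈ Finset.range n, arrivalAge (path X ω) (path S ω) 0 j := by
    rw [Finset.mul_sum, ← Finset.sum_sub_distrib]
    exact Finset.sum_congr rfl fun j _ => by ring
  rw [hexp, ← add_div, ← sub_div, ← add_div, div_right_comm]
  congr 1
  rw [div_eq_iff hp0.ne']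
  linarith

/-- The average area under the age curve per interarrival period. -/
lemma ae_tendsto_average_area :
    ∀ᵐ ω ∂μ, Tendsto (fun n : ℕ => (∑ j ∈ Finset.range n,
      (arrivalAge (path X ω) (path S ω) 0 j * min (path S ω j) (path X ω (j + 1)) +
        path X ω (j + 1) ^ 2 / 2)) / (n : ℝ)) atTop
      (𝓝 ((1 + lam * θ) ^ k / lam ^ 2)) := by
  have h1 := hXS.ae_tendsto_average_pair (measurable_snd.pow_const 2)
    (integral_pairLaw_snd_sq hlam hk hθ).1
  have h2 := hXS.ae_tendsto_average_arrivalAge_mul hlam hk hθ (measurable_fst.min measurable_snd)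
    (memLp_pairLaw_min hlam hk hθ)
  have h3 := hXS.ae_tendsto_average_arrivalAge hlam hk hθ
  rw [(integral_pairLaw_snd_sq hlam hk hθ).2] at h1
  simp only [integral_pairLaw_min hlam hk hθ] at h2
  set m := (1 - (1 + lam * θ) ^ (-k)) / lam with hm
  -- The mean of the minimum is `(1 - p) / lam` and `(1 + lam * θ) ^ k * p = 1`, so its contribution
  -- `-1 / lam ^ 2` cancels half the second moment of the interarrival time.
  have hlim : 0 + (1 + lam * θ) ^ k / lam * m + 2 / lam ^ 2 / 2 = (1 + lam * θ) ^ k / lam ^ 2 := by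
    rw [hm, Real.rpow_neg (by positivity)]
    have : 0 < (1 + lam * θ) ^ k := by positivity
    field_simp
    ring
  rw [← hlim]
  filter_upwards [h1, h2, h3] with ω h1 h2 h3
  refine ((h2.add (h3.mul_const m)).add (h1.div_const 2)).congr fun n => ?_
  have e1 : ∑ j ∈ Finset.range n, (arrivalAge (path X ω) (path S ω) 0 j *
      min (path S ω j) (path X ω (j + 1)) + path X ω (j + 1) ^ 2 / 2) =
      ∑ j ∈ Finset.range n, arrivalAge (path X ω) (path S ω) 0 j *
        (min (pair X S j ω).1 (pair X S j ω).2 - m) +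
      (∑ j ∈ Finset.range n, arrivalAge (path X ω) (path S ω) 0 j) * m +
      (∑ j ∈ Finset.range n, (pair X S j ω).2 ^ 2) / 2 := by
    rw [Finset.sum_mul, Finset.sum_div, ← Finset.sum_add_distrib, ← Finset.sum_add_distrib]
    refine Finset.sum_congr rfl fun j _ => ?_
    simp only [pair, path]
    ring
  rw [e1]
  ring

end PoissonGammaInput

/-! ### Time averages along a sample path -/

section paths

variable {x s : ℕ → ℝ} {a₀ : ℝ}

lemma finite_delivered (hx : ∀ n, 0 < x n) (htop : Tendsto (arrival x) atTop atTop) (τ : ℝ) :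
    {n | Delivered x s n ∧ arrival x n ≤ τ}.Finite := by
  obtain ⟨N, hN⟩ := (htop.eventually_gt_atTop τ).exists
  refine (Set.finite_Iio N).subset fun n hn => ?_
  exact (arrival_strictMono hx).lt_iff_lt.1 (hn.2.trans_lt hN)

open scoped Classical in
lemma numSuccess_eq_count (hx : ∀ n, 0 < x n) {n : ℕ} {τ : ℝ} (h1 : arrival x n ≤ τ)
    (h2 : τ < arrival x (n + 1)) : numSuccess x s τ = Nat.count (Delivered x s) (n + 1) := by
  rw [numSuccess, Nat.count_eq_card_filter_range, ← Set.ncard_coe_finset]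
  congr 1
  ext j
  simp only [Set.mem_ofPred_eq, Finset.coe_filter, Finset.mem_range]
  rw [and_comm]
  refine and_congr_left fun _ => ⟨fun h => ?_, fun h => ?_⟩
  · exact (arrival_strictMono hx).lt_iff_lt.1 (h.trans_lt h2)
  · exact ((arrival_strictMono hx).monotone (Nat.lt_succ_iff.1 h)).trans h1

open scoped Classical in
lemma tendsto_numSuccess_div {ρ p : ℝ} (hx : ∀ n, 0 < x n) (hρ : 0 < ρ)
    (harr : Tendsto (fun n : ℕ => arrival x n / n) atTop (𝓝 ρ))
    (hcount : Tendsto (fun n : ℕ => (Nat.count (Delivered x s) n : ℝ) / n) atTop (𝓝 p)) :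
    Tendsto (fun τ : ℝ => (numSuccess x s τ : ℝ) / τ) atTop (𝓝 (p / ρ)) := by
  have hsucc := tendsto_succ_div (c := fun n => (Nat.count (Delivered x s) n : ℝ)) hcount
  refine tendsto_div_of_between (arrival_strictMono hx).monotone hρ harr hsucc hsucc ?_
  intro n τ h1 h2
  rw [numSuccess_eq_count hx h1 h2]
  exact ⟨le_rfl, le_rfl⟩

/-- The average area under the age curve per interarrival period does not depend on the initial
age. -/
lemma tendsto_average_area {ℓ : ℝ} {j : ℕ} (hj : Delivered x s j)
    (harea : Tendsto (fun n : ℕ => (∑ i ∈ Finset.range n,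
      (arrivalAge x s 0 i * min (s i) (x (i + 1)) + x (i + 1) ^ 2 / 2)) / (n : ℝ)) atTop (𝓝 ℓ)) :
    Tendsto (fun n : ℕ => (∑ i ∈ Finset.range n,
      (arrivalAge x s a₀ i * min (s i) (x (i + 1)) + x (i + 1) ^ 2 / 2)) / (n : ℝ)) atTop
      (𝓝 ℓ) := by
  -- Total effect of the initial age; it is confined to indices up to the first known success and
  -- vanishes after division by `n`.
  set K := ∑ i ∈ Finset.range (j + 1),
    (arrivalAge x s a₀ i - arrivalAge x s 0 i) * min (s i) (x (i + 1)) with hK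
  have h := harea.add (tendsto_const_div_atTop_nhds_zero_nat K)
  rw [add_zero] at h
  refine h.congr' ?_
  filter_upwards [eventually_ge_atTop (j + 1)] with n hn
  have hKn : K = ∑ i ∈ Finset.range n,
      (arrivalAge x s a₀ i - arrivalAge x s 0 i) * min (s i) (x (i + 1)) := by
    refine Finset.sum_subset (Finset.range_mono hn) fun i _ hi => ?_
    rw [arrivalAge_congr (b₀ := 0) hj (by simpa using hi), sub_self, zero_mul]
  rw [hKn, ← add_div, ← Finset.sum_add_distrib]
  congr 1
  exact Finset.sum_congr rfl fun i _ => by ring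

/-- The age is nonnegative, so its integral up to `τ` lies between the integrals up to the
surrounding arrivals, which have the same limit per index. -/
lemma tendsto_averageAge {ρ ℓ : ℝ} (hx : ∀ n, 0 < x n) (hs : ∀ n, 0 < s n) (ha : 0 ≤ a₀)
    (hρ : 0 < ρ) (harr : Tendsto (fun n : ℕ => arrival x n / n) atTop (𝓝 ρ))
    (harea : Tendsto (fun n : ℕ => (∑ i ∈ Finset.range n,
      (arrivalAge x s a₀ i * min (s i) (x (i + 1)) + x (i + 1) ^ 2 / 2)) / (n : ℝ)) atTop (𝓝 ℓ)) :
    Tendsto (averageAge x s a₀) atTop (𝓝 (ℓ / ρ)) := by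
  have hc : Tendsto (fun n : ℕ => (∫ t in (0 : ℝ)..(arrival x n), age x s a₀ t) / n) atTop
      (𝓝 ℓ) := by
    have h := (tendsto_const_div_atTop_nhds_zero_nat
      (∫ t in (0 : ℝ)..(arrival x 0), age x s a₀ t)).add harea
    rw [zero_add] at h
    refine h.congr fun n => ?_
    rw [integral_age_zero_arrival hx hs ha n, add_div]
  have hd := tendsto_succ_div hc
  have hmono : ∀ {t t' : ℝ}, 0 ≤ t → t ≤ t' →
      ∫ u in (0 : ℝ)..t, age x s a₀ u ≤ ∫ u in (0 : ℝ)..t', age x s a₀ u := by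
    intro t t' h0 htt'
    rw [← intervalIntegral.integral_add_adjacent_intervals (b := t) (c := t')
      (intervalIntegrable_age hs _ _) (intervalIntegrable_age hs _ _)]
    exact le_add_of_nonneg_right (intervalIntegral.integral_nonneg htt'
      fun u hu => age_nonneg hs ha (h0.trans hu.1))
  have h := tendsto_div_of_between (f := fun τ => ∫ t in (0 : ℝ)..τ, age x s a₀ t)
    (arrival_strictMono hx).monotone hρ harr hc hd fun n τ h1 h2 =>
      ⟨hmono (arrival_nonneg hx n) h1, hmono ((arrival_nonneg hx n).trans h1) h2.le⟩
  refine h.congr fun τ => ?_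
  rw [averageAge, one_div_mul_eq_div]

end paths

/-! ### Expected area under the age curve -/

namespace PoissonGammaInput

variable {Ω : Type*} [MeasurableSpace Ω] {μ : Measure Ω} [IsProbabilityMeasure μ]
  {lam k θ : ℝ} {X S : ℕ → Ω → ℝ} (hlam : 0 < lam) (hk : 0 < k) (hθ : 0 < θ)
  (hXS : PoissonGammaInput μ lam k θ X S)
include hlam hk hθ hXS

lemma moment_ageArea {A₀ : Ω → ℝ} (hA₀ : ∀ ω, 0 ≤ A₀ ω) (i : ℕ) :
    Integrable (fun ω => ageArea (path X ω) (path S ω) (A₀ ω) i) μ ∧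
      ∫ ω, ageArea (path X ω) (path S ω) (A₀ ω) i ∂μ = ((1 + lam * θ) ^ k / lam) ^ 2 := by
  have hae : (fun ω => systemTime (path X ω) (path S ω) i *
      interdeparture (path X ω) (path S ω) i + interdeparture (path X ω) (path S ω) i ^ 2 / 2)
      =ᵐ[μ] fun ω => ageArea (path X ω) (path S ω) (A₀ ω) i := by
    filter_upwards [hXS.ae_pos_service, hXS.ae_pos_interarrival,
      hXS.ae_infinite_delivered hlam hk hθ] with ω hs hx hinf
    exact (ageArea_eq hx hs (hA₀ ω) hinf i).symm
  obtain ⟨h1, e1⟩ := hXS.moment_systemTime_mul_interdeparture hlam hk hθ i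
  obtain ⟨h2, e2⟩ := hXS.moment_interdeparture_sq hlam hk hθ i
  refine ⟨(h1.add (h2.div_const 2)).congr hae, ?_⟩
  rw [← integral_congr_ae hae, integral_add h1 (h2.div_const 2), integral_div, e1, e2]
  -- The terms in `E (T Y)` cancel, leaving the square of the mean interdeparture time.
  ring

end PoissonGammaInput

end LCFS

theorem mainTheorem1 {Ω : Type*} [MeasurableSpace Ω] (μ : Measure Ω) [IsProbabilityMeasure μ]
    (lam k θ : ℝ) (hlam : 0 < lam) (hk : 0 < k) (hθ : 0 < θ)
    (X S : ℕ → Ω → ℝ) (hXS : LCFS.PoissonGammaInput μ lam k θ X S)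
    (A₀ : Ω → ℝ) (hA₀ : ∀ ω, 0 ≤ A₀ ω) :
    -- almost surely the age is integrable on bounded time windows, infinitely many packets are
    -- successful, and the time-average age converges
    (∀ᵐ ω ∂μ,
      (∀ τ : ℝ, 0 ≤ τ →
        IntervalIntegrable (LCFS.age (LCFS.path X ω) (LCFS.path S ω) (A₀ ω)) volume 0 τ) ∧
      {n | LCFS.Delivered (LCFS.path X ω) (LCFS.path S ω) n}.Infinite ∧
      Tendsto (fun τ : ℝ => LCFS.averageAge (LCFS.path X ω) (LCFS.path S ω) (A₀ ω) τ) atTop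
        (𝓝 ((1 + lam * θ) ^ k / lam))) ∧
    -- the limit is the effective rate times the expected area
    (∀ i : ℕ,
      Integrable (fun ω => LCFS.ageArea (LCFS.path X ω) (LCFS.path S ω) (A₀ ω) i) μ) ∧
    (∀ n i : ℕ,
      LCFS.effectiveRate μ lam X S n *
          ∫ ω, LCFS.ageArea (LCFS.path X ω) (LCFS.path S ω) (A₀ ω) i ∂μ =
        (1 + lam * θ) ^ k / lam) ∧
    -- the effective rate
    (∀ n : ℕ, LCFS.effectiveRate μ lam X S n = lam * (1 + lam * θ) ^ (-k)) ∧
    (∀ᵐ ω ∂μ,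
      (∀ τ : ℝ, {n | LCFS.Delivered (LCFS.path X ω) (LCFS.path S ω) n ∧
        LCFS.arrival (LCFS.path X ω) n ≤ τ}.Finite) ∧
      Tendsto (fun τ : ℝ => (LCFS.numSuccess (LCFS.path X ω) (LCFS.path S ω) τ : ℝ) / τ) atTop
        (𝓝 (lam * (1 + lam * θ) ^ (-k)))) ∧
    -- the law of the system time of a successful packet
    (∀ i : ℕ, HasLaw (fun ω => LCFS.systemTime (LCFS.path X ω) (LCFS.path S ω) i)
      (gammaMeasure k ((1 + lam * θ) / θ)) μ) ∧
    -- the moment generating function of the interdeparture time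
    (∀ (i : ℕ) (z : ℝ), z < lam → z * (1 + θ * (lam - z)) ^ k < lam →
      Integrable (fun ω =>
        Real.exp (z * LCFS.interdeparture (LCFS.path X ω) (LCFS.path S ω) i)) μ ∧
      mgf (fun ω => LCFS.interdeparture (LCFS.path X ω) (LCFS.path S ω) i) μ z =
        lam / (lam - z * (1 + θ * (lam - z)) ^ k)) := by
  have hp : 0 < (1 + lam * θ) ^ k := by positivity
  have hpn : (1 + lam * θ) ^ (-k) = ((1 + lam * θ) ^ k)⁻¹ := Real.rpow_neg (by positivity) k
  refine ⟨?_, fun i => (hXS.moment_ageArea hlam hk hθ hA₀ i).1, fun n i => ?_,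
    hXS.effectiveRate_eq hlam hk hθ, ?_, hXS.hasLaw_systemTime hlam hk hθ,
    fun i z hz hz' => hXS.mgf_interdeparture hlam hk hθ hz hz' i⟩
  · filter_upwards [hXS.ae_pos_service, hXS.ae_pos_interarrival,
      hXS.ae_infinite_delivered hlam hk hθ, hXS.ae_tendsto_arrival_div hlam hk hθ,
      hXS.ae_tendsto_average_area hlam hk hθ] with ω hs hx hinf harr harea
    refine ⟨fun τ _ => LCFS.intervalIntegrable_age hs 0 τ, hinf, ?_⟩
    obtain ⟨j, hj⟩ := hinf.nonempty
    have h := LCFS.tendsto_averageAge hx hs (hA₀ ω) (one_div_pos.2 hlam) harr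
      (LCFS.tendsto_average_area hj harea)
    rwa [show (1 + lam * θ) ^ k / lam ^ 2 / (1 / lam) = (1 + lam * θ) ^ k / lam by
      field_simp] at h
  · rw [hXS.effectiveRate_eq hlam hk hθ, (hXS.moment_ageArea hlam hk hθ hA₀ i).2, hpn]
    field_simp
  · filter_upwards [hXS.ae_pos_interarrival, hXS.ae_tendsto_arrival_div hlam hk hθ,
      hXS.ae_tendsto_count hlam hk hθ] with ω hx harr hcount
    have hlam' : 0 < 1 / lam := one_div_pos.2 hlam
    refine ⟨LCFS.finite_delivered hx (LCFS.tendsto_atTop_of_div hlam' harr), ?_⟩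
    have h := LCFS.tendsto_numSuccess_div hx hlam' harr hcount
    rwa [div_div_eq_mul_div, div_one, mul_comm] at h
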